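/- **Conventions.** Manifolds are smooth, connected, Hausdorff and without boundary. For a Riemannian metric $g$ with Levi-Civita connection $\nabla$, $R(X,Y)Z=\nabla_X\nabla_YZ-\nabla_Y\nabla_XZ-\nabla_{[X,Y]}Z$, the sectional curvature of the plane spanned by $X,Y$ is $K(X,Y)=g(R(X,Y)Y,X)/\big(g(X,X)g(Y,Y)-g(X,Y)^2\big)$, and for a $1$-form $\eta$, $d\eta(X,Y)=\tfrac12\big(X\eta(Y)-Y\eta(X)-\eta([X,Y])\big)$. A *metric $f$-manifold* $(M,f,\xi_1,\dots,\xi_s,\eta_1,\dots,\eta_s,g)$ of dimension $2n+s$, $s\ge 1$, is a Riemannian manifold $(M,g)$ with a $(1,1)$-tensor field $f$ of rank $2n$ satisfying $f^3+f=0$, vector fields $\xi_\alpha$ and $1$-forms $\eta_\alpha$ such that $\eta_\alpha(\xi_\beta)=\delta_{\alpha\beta}$, $f\xi_\alpha=0$, $\eta_\alpha\circ f=0$, $f^2=-I+\sum_\alpha\eta_\alpha\otimes\xi_\alpha$ and $g(fX,fY)=g(X,Y)-\sum_\alpha\eta_\alpha(X)\eta_\alpha(Y)$. It is *metric $f$-contact*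 if $d\eta_\alpha(X,Y)=g(X,fY)$ for all $\alpha$, $X$, $Y$. Put $\overline\xi=\sum_\alpha\xi_\alpha$, $\overline\eta=\sum_\alpha\eta_\alpha$ and $h_\alpha=\tfrac12 L_{\xi_\alpha}f$. For real constants $\kappa,\mu$, a *metric $f$-$(\kappa,\mu)$ manifold* is a metric $f$-contact manifold such that, for all $\alpha$, $X$, $Y$, $$R(X,Y)\xi_\alpha=\kappa\big(\overline\eta(X)f^2Y-\overline\eta(Y)f^2X\big)+\mu\big(\overline\eta(Y)h_\alpha X-\overline\eta(X)h_\alpha Y\big).$$ An *$f$-section* at $p\in M$ is a plane in $T_pM$ spanned by $v$ and $fv$, where $v\neq0$ and $\eta_\alpha(v)=0$ for all $\alpha$; its sectional curvature is called an *$f$-sectional curvature* at $p$. **Theorem 3.1.** Let $M$ be a $(2n+s)$-dimensional metric $f$-$(\kappa,\mu)$ manifold with $n>1$ and $s\ge1$. Suppose that at each point $p\in M$ the $f$-sectional curvature does not depend on the $f$-section at $p$. Then $h_1=\dots=h_s=:h$, and the $f$-sectional curvature is a constant $H$ on $M$ (that is, $M$ is an $f$-$(\kappa,\mu)$-space-form).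 The curvature tensor is given, for all vector fields $X,Y,Z$, by $$\begin{aligned} 4R(X,Y)Z={}&(H+3s)\Big(g(f^2Y,Z)f^2X-g(f^2X,Z)f^2Y\Big)\\ &+(H-s)\Big(2g(fY,X)fZ+g(X,fZ)fY-g(Y,fZ)fX\Big)\\ &-2s\Big(g(hX,Z)hY-g(hY,Z)hX-g(fhX,Z)fhY+g(fhY,Z)fhX\\ &\qquad-2g(f^2X,Z)hY+2g(f^2Y,Z)hX-2g(hX,Z)f^2Y+2g(hY,Z)f^2X\Big)\\ &+4\kappa\Big(\overline\eta(X)\overline\eta(Z)f^2Y-\overline\eta(X)g(Y,f^2Z)\overline\xi-\overline\eta(Y)\overline\eta(Z)f^2X+\overline\eta(Y)g(X,f^2Z)\overline\xi\Big)\\ &+4\mu\Big(\overline\eta(Y)\overline\eta(Z)hX-\overline\eta(Y)g(X,hZ)\overline\xi-\overline\eta(X)\overline\eta(Z)hY+\overline\eta(X)g(Y,hZ)\overline\xi\Big). \end{aligned}$$ If moreover $\kappa<1$, then $\mu=\kappa+1$ and $H=-s(2\kappa+1)$. -/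

import Mathlib

open scoped Manifold ContDiff Bundle

noncomputable section

namespace FKappaMu

section Riemannian

variable {E : Type*} [NormedAddCommGroup E] [NormedSpace ℝ E]
  {M : Type*} [TopologicalSpace M] [ChartedSpace E M] [IsManifold 𝓘(ℝ, E) ∞ M]

/-- (Not necessarily smooth) vector fields on `M`. -/
abbrev VField (E : Type*) [NormedAddCommGroup E] [NormedSpace ℝ E]
    (M : Type*) [TopologicalSpace M] [ChartedSpace E M] : Type _ :=
  (p : M) → TangentSpace 𝓘(ℝ, E) p

/-- `X` belongs to `𝒳(M)`: it is a smooth section of the tangent bundle. -/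
def IsSmoothVF (X : VField E M) : Prop :=
  ContMDiff 𝓘(ℝ, E) (𝓘(ℝ, E).prod 𝓘(ℝ, E)) ∞
    (fun p ↦ Bundle.TotalSpace.mk' E (E := (TangentSpace 𝓘(ℝ, E) : M → Type _)) p (X p))

/-- Smooth Riemannian metrics on `M`. -/
abbrev Metric (E : Type*) [NormedAddCommGroup E] [NormedSpace ℝ E]
    (M : Type*) [TopologicalSpace M] [ChartedSpace E M] [IsManifold 𝓘(ℝ, E) ∞ M] : Type _ :=
  Bundle.ContMDiffRiemannianMetric 𝓘(ℝ, E) ∞ E (TangentSpace 𝓘(ℝ, E) : M → Type _)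

/-- The derivative `X φ` at `p` of a function `φ` along a vector field `X`. -/
def dirDeriv (X : VField E M) (φ : M → ℝ) (p : M) : ℝ :=
  mvfderiv 𝓘(ℝ, E) φ p (X p)

/-- The Lie bracket `[X, Y]`. -/
def bracket (X Y : VField E M) : VField E M :=
  VectorField.mlieBracket 𝓘(ℝ, E) X Y

/-- The function `g(X, Y)`. -/
def Metric.ip (g : Metric E M) (X Y : VField E M) (p : M) : ℝ :=
  g.inner p (X p) (Y p)

/-- The right-hand side of the Koszul formula for `g(∇_X Y, Z)`. -/
def Metric.koszul (g : Metric E M) (X Y Z : VField E M) (p : M) : ℝ :=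
  (1 / 2) * (dirDeriv X (g.ip Y Z) p + dirDeriv Y (g.ip X Z) p - dirDeriv Z (g.ip X Y) p
    + g.ip (bracket X Y) Z p - g.ip (bracket X Z) Y p - g.ip (bracket Y Z) X p)

open Classical in
/-- The Levi-Civita connection of `g`: for smooth `X`, `Y`, the value `(∇_X Y)(p)` is the tangent
vector determined by the Koszul formula (see `Metric.nabla_spec` and `Metric.nabla_unique`). -/
def Metric.nabla (g : Metric E M) (X Y : VField E M) : VField E M := fun p ↦
  if h : ∃ v : TangentSpace 𝓘(ℝ, E) p, ∀ Z : VField E M, IsSmoothVF Z →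
      g.inner p v (Z p) = g.koszul X Y Z p
  then h.choose else 0

section NablaSpec

/-- `g(X, Y)` is differentiable where `X` and `Y` are. -/
theorem ip_mdiffAt (g : Metric E M) {X Y : VField E M} {p : M}
    (hX : MDiffAt (T% X) p) (hY : MDiffAt (T% Y) p) : MDiffAt (g.ip X Y) p := by
  have h := MDifferentiableAt.clm_bundle_apply₂ (IM := 𝓘(ℝ, E)) (IB := 𝓘(ℝ, E)) (b := id)
    (F₁ := E) (F₂ := E) (F₃ := ℝ) (E₁ := (TangentSpace 𝓘(ℝ, E) : M → Type _))
    (E₂ := (TangentSpace 𝓘(ℝ, E) : M → Type _)) (E₃ := Bundle.Trivial M ℝ)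
    (ψ := g.inner) (v := X) (w := Y) (x := p)
    ((g.contMDiff p).mdifferentiableAt (by simp)) hX hY
  exact ((mdifferentiableAt_totalSpace ..).1 h).2

/-- The Koszul expression is tensorial in its last argument. -/
theorem koszul_tensorial [FiniteDimensional ℝ E] (g : Metric E M) {X Y : VField E M} {p : M}
    (hX : MDiffAt (T% X) p) (hY : MDiffAt (T% Y) p) :
    TensorialAt 𝓘(ℝ, E) E (fun Z ↦ g.koszul X Y Z p) p where
  smul {φ Z} hφ hZ := by
    have h1 : g.ip Y (φ • Z) = fun q ↦ φ q * g.ip Y Z q := by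
      ext q; simp [Metric.ip]
    have h2 : g.ip X (φ • Z) = fun q ↦ φ q * g.ip X Z q := by
      ext q; simp [Metric.ip]
    have s1 := g.symm p (X p) (Z p)
    have s2 := g.symm p (Y p) (Z p)
    simp [Metric.koszul, dirDeriv, h1, h2, mvfderiv_fun_mul hφ (ip_mdiffAt g hY hZ),
      mvfderiv_fun_mul hφ (ip_mdiffAt g hX hZ), bracket]
    simp [Metric.ip, s1, s2, VectorField.mlieBracket_smul_right hφ hZ]
    ring
  add {Z Z'} hZ hZ' := by
    have h1 : g.ip Y (Z + Z') = fun q ↦ g.ip Y Z q + g.ip Y Z' q := by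
      ext q; simp [Metric.ip]
    have h2 : g.ip X (Z + Z') = fun q ↦ g.ip X Z q + g.ip X Z' q := by
      ext q; simp [Metric.ip]
    simp [Metric.koszul, dirDeriv, h1, h2, mvfderiv_fun_add (ip_mdiffAt g hY hZ) (ip_mdiffAt g hY hZ'),
      mvfderiv_fun_add (ip_mdiffAt g hX hZ) (ip_mdiffAt g hX hZ'), bracket]
    simp [Metric.ip, VectorField.mlieBracket_add_right hZ hZ']
    ring

/-- Smooth vector fields are differentiable. -/
theorem IsSmoothVF.mdiffAt {X : VField E M} (hX : IsSmoothVF X) (p : M) : MDiffAt (T% X) p :=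
  (hX p).mdifferentiableAt (by simp)

/-- Every tangent vector is the value of a smooth vector field. -/
theorem exists_isSmoothVF [FiniteDimensional ℝ E] [T2Space M] {p : M}
    (v : TangentSpace 𝓘(ℝ, E) p) : ∃ X : VField E M, IsSmoothVF X ∧ X p = v := by
  obtain ⟨t, ht, hs⟩ := FiberBundle.exists_contMDiffOn_extend (k := ∞) 𝓘(ℝ, E) E v
  obtain ⟨u, hut, hu, hpu⟩ := mem_nhds_iff.1 ht
  obtain ⟨φ, hφ⟩ := (SmoothBumpFunction.nhds_basis_tsupport (I := 𝓘(ℝ, E)) p).mem_iff.1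
    (hu.mem_nhds hpu)
  refine ⟨(φ : M → ℝ) • FiberBundle.extend E v, ?_, ?_⟩
  · exact ContMDiffOn.smul_section_of_tsupport φ.contMDiff.contMDiffOn hu hφ.2 (hs.mono hut)
  · simp

/-- The Koszul formula characterizes the Levi-Civita connection: existence. -/
theorem Metric.nabla_spec [FiniteDimensional ℝ E] (g : Metric E M) {X Y Z : VField E M}
    (hX : IsSmoothVF X) (hY : IsSmoothVF Y) (hZ : IsSmoothVF Z) (p : M) :
    g.inner p (g.nabla X Y p) (Z p) = g.koszul X Y Z p := by
  have key : ∃ v : TangentSpace 𝓘(ℝ, E) p, ∀ Z : VField E M, IsSmoothVF Z →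
      g.inner p v (Z p) = g.koszul X Y Z p := by
    have ht := koszul_tensorial g (hX.mdiffAt p) (hY.mdiffAt p)
    have : FiniteDimensional ℝ (TangentSpace 𝓘(ℝ, E) p) := inferInstanceAs (FiniteDimensional ℝ E)
    let B : TangentSpace 𝓘(ℝ, E) p →ₗ[ℝ] Module.Dual ℝ (TangentSpace 𝓘(ℝ, E) p) :=
      { toFun := fun v ↦ (g.inner p v).toLinearMap
        map_add' := by intros; ext; simp
        map_smul' := by intros; ext; simp }
    have hB : Function.Injective B := by
      rw [← LinearMap.ker_eq_bot, LinearMap.ker_eq_bot']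
      intro v hv
      by_contra hne
      exact (g.pos p v hne).ne' (LinearMap.congr_fun hv v)
    obtain ⟨v, hv⟩ := (LinearMap.injective_iff_surjective_of_finrank_eq_finrank
      (Subspace.dual_finrank_eq).symm).1 hB (TensorialAt.mkHom _ p ht).toLinearMap
    refine ⟨v, fun Z hZ ↦ ?_⟩
    exact (LinearMap.congr_fun hv (Z p)).trans (TensorialAt.mkHom_apply ht (hZ.mdiffAt p))
  rw [Metric.nabla, dif_pos key]
  exact key.choose_spec Z hZ

/-- The Koszul formula characterizes the Levi-Civita connection: uniqueness. -/
theorem Metric.nabla_unique [FiniteDimensional ℝ E] [T2Space M] (g : Metric E M)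
    {X Y : VField E M} {p : M} {v : TangentSpace 𝓘(ℝ, E) p}
    (hv : ∀ Z : VField E M, IsSmoothVF Z → g.inner p v (Z p) = g.koszul X Y Z p) :
    g.nabla X Y p = v := by
  have key : ∃ v : TangentSpace 𝓘(ℝ, E) p, ∀ Z : VField E M, IsSmoothVF Z →
      g.inner p v (Z p) = g.koszul X Y Z p := ⟨v, hv⟩
  rw [Metric.nabla, dif_pos key]
  by_contra hne
  obtain ⟨Z, hZ, hZp⟩ := exists_isSmoothVF (key.choose - v)
  have h0 := g.pos p _ (sub_ne_zero.2 hne)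
  have h1 := key.choose_spec Z hZ
  have h2 := hv Z hZ
  rw [hZp] at h1 h2
  rw [map_sub, g.symm, h1, g.symm, h2, sub_self] at h0
  exact lt_irrefl _ h0

end NablaSpec

/-- The curvature tensor `R(X, Y)Z = ∇_X ∇_Y Z - ∇_Y ∇_X Z - ∇_{[X, Y]} Z`. -/
def Metric.curvature (g : Metric E M) (X Y Z : VField E M) : VField E M := fun p ↦
  g.nabla X (g.nabla Y Z) p - g.nabla Y (g.nabla X Z) p - g.nabla (bracket X Y) Z p

/-- The sectional curvature at `p` of the plane spanned by `X p` and `Y p`. -/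
def Metric.sectional (g : Metric E M) (X Y : VField E M) (p : M) : ℝ :=
  g.ip (g.curvature X Y Y) X p / (g.ip X X p * g.ip Y Y p - g.ip X Y p ^ 2)

/-- A smooth `1`-form, as a smooth section of the cotangent bundle. -/
def IsSmoothForm (θ : (p : M) → TangentSpace 𝓘(ℝ, E) p →L[ℝ] ℝ) : Prop :=
  ContMDiff 𝓘(ℝ, E) (𝓘(ℝ, E).prod 𝓘(ℝ, E →L[ℝ] ℝ)) ∞
    (fun p ↦ Bundle.TotalSpace.mk' (E →L[ℝ] ℝ)
      (E := fun p : M ↦ TangentSpace 𝓘(ℝ, E) p →L[ℝ] ℝ) p (θ p))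

/-- A smooth tensor field of type `(1,1)`, as a smooth section of `End(TM)`. -/
def IsSmoothEnd (A : (p : M) → TangentSpace 𝓘(ℝ, E) p →L[ℝ] TangentSpace 𝓘(ℝ, E) p) : Prop :=
  ContMDiff 𝓘(ℝ, E) (𝓘(ℝ, E).prod 𝓘(ℝ, E →L[ℝ] E)) ∞
    (fun p ↦ Bundle.TotalSpace.mk' (E →L[ℝ] E)
      (E := fun p : M ↦ TangentSpace 𝓘(ℝ, E) p →L[ℝ] TangentSpace 𝓘(ℝ, E) p) p (A p))

/-- The exterior derivative of a `1`-form, in the convention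
`dθ(X, Y) = (1/2) (X θ(Y) - Y θ(X) - θ([X, Y]))` customary in contact metric geometry. -/
def extD (θ : (p : M) → TangentSpace 𝓘(ℝ, E) p →L[ℝ] ℝ) (X Y : VField E M) (p : M) : ℝ :=
  (1 / 2) * (dirDeriv X (fun q ↦ θ q (Y q)) p - dirDeriv Y (fun q ↦ θ q (X q)) p
    - θ p (bracket X Y p))

end Riemannian

/-- A metric `f`-structure `(f, ξ₁, …, ξ_s, η₁, …, η_s, g)` on a manifold `M` modelled on `E`
(with `dim E = 2n + s`). -/
structure MetricFStructure (n s : ℕ) (E : Type*) [NormedAddCommGroup E] [NormedSpace ℝ E]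
    (M : Type*) [TopologicalSpace M] [ChartedSpace E M] [IsManifold 𝓘(ℝ, E) ∞ M] where
  /-- the Riemannian metric -/
  g : Metric E M
  /-- the `f`-structure -/
  f : (p : M) → TangentSpace 𝓘(ℝ, E) p →L[ℝ] TangentSpace 𝓘(ℝ, E) p
  /-- the structure vector fields -/
  ξ : Fin s → VField E M
  /-- the structure `1`-forms -/
  η : Fin s → (p : M) → TangentSpace 𝓘(ℝ, E) p →L[ℝ] ℝ
  smooth_f : IsSmoothEnd f
  smooth_ξ : ∀ α, IsSmoothVF (ξ α)
  smooth_η : ∀ α, IsSmoothForm (η α)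
  rank_f : ∀ p, Module.finrank ℝ (LinearMap.range (f p).toLinearMap) = 2 * n
  f_cube : ∀ p v, f p (f p (f p v)) + f p v = 0
  η_ξ : ∀ α β p, η α p (ξ β p) = if α = β then 1 else 0
  f_ξ : ∀ α p, f p (ξ α p) = 0
  η_f : ∀ α p v, η α p (f p v) = 0
  f_sq : ∀ p v, f p (f p v) = -v + ∑ α, η α p v • ξ α p
  g_f_f : ∀ p v w, g.inner p (f p v) (f p w) = g.inner p v w - ∑ α, η α p v * η α p w

namespace MetricFStructure

variable {n s : ℕ} {E : Type*} [NormedAddCommGroup E] [NormedSpace ℝ E]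
  {M : Type*} [TopologicalSpace M] [ChartedSpace E M] [IsManifold 𝓘(ℝ, E) ∞ M]
  (S : MetricFStructure n s E M)

/-- The vector field `f X`. -/
def fV (X : VField E M) : VField E M := fun p ↦ S.f p (X p)

/-- `ξ̄ = ξ₁ + ⋯ + ξ_s`. -/
def ξbar : VField E M := fun p ↦ ∑ α, S.ξ α p

/-- The function `η̄(X)`, where `η̄ = η₁ + ⋯ + η_s`. -/
def ηbar (X : VField E M) (p : M) : ℝ := ∑ α, S.η α p (X p)

/-- `h_α X = (1/2) (L_{ξ_α} f) X = (1/2) ([ξ_α, f X] - f [ξ_α, X])`. -/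
def h (α : Fin s) (X : VField E M) : VField E M := fun p ↦
  (1 / 2 : ℝ) • (bracket (S.ξ α) (S.fV X) p - S.f p (bracket (S.ξ α) X p))

/-- Metric `f`-contact manifolds (almost `S`-manifolds): `dη_α = F` for every `α`, where
`F(X, Y) = g(X, f Y)`. -/
def IsMetricFContact : Prop :=
  ∀ α, ∀ X Y : VField E M, IsSmoothVF X → IsSmoothVF Y → ∀ p,
    extD (S.η α) X Y p = S.g.ip X (S.fV Y) p

/-- Metric `f`-`(κ,μ)` manifolds: metric `f`-contact manifolds which satisfy the
`(κ,μ)`-nullity condition. -/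
def IsFKappaMu (κ μ : ℝ) : Prop :=
  S.IsMetricFContact ∧
  ∀ α, ∀ X Y : VField E M, IsSmoothVF X → IsSmoothVF Y → ∀ p,
    S.g.curvature X Y (S.ξ α) p =
      κ • (S.ηbar X p • S.fV (S.fV Y) p - S.ηbar Y p • S.fV (S.fV X) p)
      + μ • (S.ηbar Y p • S.h α X p - S.ηbar X p • S.h α Y p)

/-- All `f`-sections at `p`, i.e. all planes spanned by `v` and `f v` where `v ≠ 0` lies in
`𝓛_p` (that is, `η_α(v) = 0` for all `α`), have sectional curvature `c`. Tangent vectors at `p`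
are written as values of smooth vector fields. -/
def FSectionalCurvatureEqAt (p : M) (c : ℝ) : Prop :=
  ∀ X : VField E M, IsSmoothVF X → X p ≠ 0 → (∀ α, S.η α p (X p) = 0) →
    S.g.sectional X (S.fV X) p = c

/-- The explicit form of the curvature tensor of an `f`-`(κ,μ)`-space-form of constant
`f`-sectional curvature `H`, where `h` denotes the operator `h₁ = ⋯ = h_s`. -/
def CurvatureFormula (κ μ H : ℝ) (h : VField E M → VField E M) : Prop :=
  ∀ X Y Z : VField E M, IsSmoothVF X → IsSmoothVF Y → IsSmoothVF Z → ∀ p,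
    letI g : VField E M → VField E M → ℝ := fun U V ↦ S.g.ip U V p
    letI f : VField E M → VField E M := S.fV
    letI ηb : VField E M → ℝ := fun U ↦ S.ηbar U p
    (4 : ℝ) • S.g.curvature X Y Z p =
      (H + 3 * s) • (g (f (f Y)) Z • f (f X) p - g (f (f X)) Z • f (f Y) p)
      + (H - s) • ((2 * g (f Y) X) • f Z p + g X (f Z) • f Y p - g Y (f Z) • f X p)
      - (2 * s : ℝ) • (g (h X) Z • h Y p - g (h Y) Z • h X p
          - g (f (h X)) Z • f (h Y) p + g (f (h Y)) Z • f (h X) p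
          - (2 * g (f (f X)) Z) • h Y p + (2 * g (f (f Y)) Z) • h X p
          - (2 * g (h X) Z) • f (f Y) p + (2 * g (h Y) Z) • f (f X) p)
      + (4 * κ) • ((ηb X * ηb Z) • f (f Y) p - (ηb X * g Y (f (f Z))) • S.ξbar p
          - (ηb Y * ηb Z) • f (f X) p + (ηb Y * g X (f (f Z))) • S.ξbar p)
      + (4 * μ) • ((ηb Y * ηb Z) • h X p - (ηb Y * g X (h Z)) • S.ξbar p
          - (ηb X * ηb Z) • h Y p + (ηb X * g Y (h Z)) • S.ξbar p)

end MetricFStructure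

end FKappaMu

end

/-! Everything is governed by `∇ξ_α`. The contact condition fixes its skew part, so `∇_X ξ_α = B_α X
- f X` with `B_α` symmetric. Closedness of the fundamental form yields `∇_{ξ_α} ξ_β = 0` and `f B_α
= -B_α f`, whence `h_α = f B_α`. Nullity with `ξ_β` in one slot gives `B_α B_β = (κ - 1) f²` for all
`α, β`; so the symmetric operator `B_α - B_β` has square zero and vanishes (`B_eq`). Write `b` for
the common value. On horizontal fields `|bX|² = (1 - κ)|X|²`, so `κ ≤ 1`.

On horizontal fields nullity is a Codazzi equation. With closedness it kills the horizontal parts of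
`∇f` and `∇b` (`horForm_eq_zero`), so both become explicit (`covEnd_f`, `covEnd_b`), and with them
the commutators of `R` with `f` and `b`. The difference between `4R` and the claimed expression is
then, horizontally, a Kähler-like tensor with zero holomorphic sectional curvature, hence zero
(`kaehlerLike_eq_zero`). Components containing some `ξ_α` are prescribed by nullity.

If `κ < 1`, then `b` has eigenvalues `±√(1 - κ)`, and commuting `R` with `b` on eigenfields gives `H
+ s(κ + μ) = 0` and, using `n > 1`, `H - s + 2sμ = 0`; these determine `μ` and `H`. If `κ = 1`, then
`b = 0` and a Schur argument with the second Bianchi identity gives `dH = 0`.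

The tensor calculus takes place on a module `V` over a ring `F` of functions. Analysis enters when
this model is realised by smooth fields and when fields nonzero at a given point are chosen. -/

noncomputable section

namespace FKappaMu

/-! ### Levi-Civita calculus and curvature identities over a ring of functions. -/

section Algebraic

/-- In an algebra over `ℝ`, nonzero real scalars can be cancelled. -/
theorem eq_zero_of_algebraMap_mul {F : Type*} [CommRing F] [Algebra ℝ F] {a : F} (c : ℝ)
    (hc : c ≠ 0) (h : algebraMap ℝ F c * a = 0) : a = 0 := by
  have h1 : algebraMap ℝ F (c⁻¹) * (algebraMap ℝ F c * a) = a := by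
    rw [← mul_assoc, ← map_mul, inv_mul_cancel₀ hc, map_one, one_mul]
  rw [← h1, h, mul_zero]

theorem eq_zero_of_ofNat_mul {F : Type*} [CommRing F] [Algebra ℝ F] {a : F} (n : ℕ) [NeZero n]
    (h : (n : F) * a = 0) : a = 0 :=
  eq_zero_of_algebraMap_mul (n : ℝ) (Nat.cast_ne_zero.2 (NeZero.ne n)) (by rwa [map_natCast])

theorem eq_zero_of_two_mul {F : Type*} [CommRing F] [Algebra ℝ F] {a : F}
    (h : 2 * a = 0) : a = 0 :=
  eq_zero_of_ofNat_mul 2 (by exact_mod_cast h)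

/-- The algebraic data of a Riemannian manifold: the metric, the action of vector fields on
functions and the Levi-Civita connection, on a module `V` of vector fields over a ring `F` of
functions. -/
structure LeviCivita (F V : Type*) [CommRing F] [Algebra ℝ F] [AddCommGroup V] [Module F V] where
  /-- the metric -/
  g : V →ₗ[F] V →ₗ[F] F
  /-- the action of vector fields on functions -/
  d : V →ₗ[F] Derivation ℝ F F
  /-- the connection -/
  D : V →ₗ[F] V →+ V
  g_symm : ∀ X Y, g X Y = g Y X
  g_definite : ∀ X, g X X = 0 → X = 0
  D_smul : ∀ X (a : F) Y, D X (a • Y) = a • D X Y + d X a • Y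
  d_g : ∀ X Y Z, d X (g Y Z) = g (D X Y) Z + g Y (D X Z)
  d_bracket : ∀ X Y a, d (D X Y - D Y X) a = d X (d Y a) - d Y (d X a)
  jacobi : ∀ X Y Z,
    D (D X Y - D Y X) Z - D Z (D X Y - D Y X) + (D (D Y Z - D Z Y) X - D X (D Y Z - D Z Y))
      + (D (D Z X - D X Z) Y - D Y (D Z X - D X Z)) = 0

namespace LeviCivita

variable {F V : Type*} [CommRing F] [Algebra ℝ F] [AddCommGroup V] [Module F V]
  (L : LeviCivita F V)

theorem ext_g {X Y : V} (h : ∀ Z, L.g X Z = L.g Y Z) : X = Y := by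
  rw [← sub_eq_zero]
  apply L.g_definite
  rw [LinearMap.map_sub₂, h, sub_self]

/-- The covariant derivative of an endomorphism field. -/
def covEnd (T : V →ₗ[F] V) : V →ₗ[F] V →ₗ[F] V :=
  LinearMap.mk₂ F (fun X Y ↦ L.D X (T Y) - T (L.D X Y))
    (fun X X' Y ↦ by simp only [map_add, AddMonoidHom.add_apply]; abel)
    (fun a X Y ↦ by simp only [map_smul, AddMonoidHom.smul_apply, smul_sub])
    (fun X Y Y' ↦ by simp only [map_add]; abel)
    (fun a X Y ↦ by simp only [map_smul, L.D_smul, map_add]; module)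

theorem covEnd_apply (T : V →ₗ[F] V) (X Y : V) :
    L.covEnd T X Y = L.D X (T Y) - T (L.D X Y) := rfl

/-- The endomorphism field `∇Z`. -/
def grad (Z : V) : V →ₗ[F] V where
  toFun X := L.D X Z
  map_add' X Y := by simp
  map_smul' a X := by simp

@[simp] theorem grad_apply (X Z : V) : L.grad Z X = L.D X Z := rfl

/-- The curvature tensor. -/
def R : V →ₗ[F] V →ₗ[F] V →ₗ[F] V :=
  LinearMap.mk₂ F (fun X Y ↦
    { toFun := fun Z ↦ L.D X (L.D Y Z) - L.D Y (L.D X Z) - L.D (L.D X Y - L.D Y X) Z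
      map_add' := fun Z Z' ↦ by simp only [map_add]; abel
      map_smul' := fun a Z ↦ by
        have := L.d_bracket X Y a
        simp only [L.D_smul, map_add, this, RingHom.id_apply]
        module })
    (fun X X' Y ↦ by ext Z; simp; abel)
    (fun a X Y ↦ by ext Z; simp [L.D_smul]; module)
    (fun X X' Y ↦ by ext Z; simp; abel)
    (fun a X Y ↦ by ext Z; simp [L.D_smul]; module)

theorem R_apply (X Y Z : V) :
    L.R X Y Z = L.D X (L.D Y Z) - L.D Y (L.D X Z) - L.D (L.D X Y - L.D Y X) Z := rfl

theorem R_antisymm (X Y Z : V) : L.R Y X Z = -L.R X Y Z := by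
  simp only [R_apply, map_sub, AddMonoidHom.sub_apply]; abel

theorem bianchi_first (X Y Z : V) : L.R X Y Z + L.R Y Z X + L.R Z X Y = 0 := by
  rw [← neg_eq_zero, ← L.jacobi X Y Z]
  simp only [R_apply, map_sub, AddMonoidHom.sub_apply]; abel

theorem g_R_skew (X Y Z W : V) : L.g (L.R X Y Z) W = -L.g (L.R X Y W) Z := by
  have h := L.d_bracket X Y (L.g Z W)
  simp only [L.d_g, map_add] at h
  simp only [R_apply, map_sub, LinearMap.sub_apply, L.g_symm _ Z] at h ⊢
  linear_combination -h

/-- The octahedron argument: a signed sum of four first Bianchi identities, reduced by the two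
skew-symmetries, is twice the claim. -/
theorem g_R_pair (X Y Z W : V) : L.g (L.R X Y Z) W = L.g (L.R Z W X) Y := by
  have b := fun X Y Z W ↦ congrArg (fun U ↦ L.g U W) (L.bianchi_first X Y Z)
  simp only [map_add, LinearMap.add_apply, map_zero, LinearMap.zero_apply] at b
  have a := fun X Y Z W ↦ congrArg (fun U ↦ L.g U W) (L.R_antisymm X Y Z)
  simp only [map_neg, LinearMap.neg_apply] at a
  have c := L.g_R_skew
  rw [← sub_eq_zero]
  apply eq_zero_of_two_mul
  linear_combination b X Y Z W + b Y Z W X - b Z W X Y - b W X Y Z - c Y Z W X - c Z W Y X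
    - a Y W Z X + a X W Z Y - c X W Z Y + a Z X W Y - c Z X W Y + a X W Y Z + c X Y W Z + c Y W X Z

/-- The covariant derivative of the curvature tensor. -/
def covR (X Y Z W : V) : V :=
  L.D X (L.R Y Z W) - L.R (L.D X Y) Z W - L.R Y (L.D X Z) W - L.R Y Z (L.D X W)

/-- After expansion the cyclic sum is the derivative of `W` along the Jacobi expression, which is
zero. -/
theorem bianchi_second (X Y Z W : V) :
    L.covR X Y Z W + L.covR Y Z X W + L.covR Z X Y W = 0 := by
  have h := congrArg (fun U ↦ L.D U W) (L.jacobi X Y Z)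
  simp only [covR, R_apply, map_sub, map_add, AddMonoidHom.sub_apply, AddMonoidHom.add_apply,
    map_zero, AddMonoidHom.zero_apply] at h ⊢
  rw [← h]
  abel

theorem g_covR (X Y Z W U : V) :
    L.g (L.covR X Y Z W) U = L.d X (L.g (L.R Y Z W) U) - L.g (L.R (L.D X Y) Z W) U
      - L.g (L.R Y (L.D X Z) W) U - L.g (L.R Y Z (L.D X W)) U - L.g (L.R Y Z W) (L.D X U) := by
  simp only [covR, map_sub, LinearMap.sub_apply, L.d_g]
  ring

end LeviCivita
end Algebraic

/-! ### Metric `f`-contact structures: the symmetric and skew parts of `∇ξ_α`. -/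

section Contact

/-- The algebraic data of a metric `f`-contact manifold. -/
structure FContact (F V ι : Type*) [CommRing F] [Algebra ℝ F] [AddCommGroup V] [Module F V]
    [Fintype ι] [DecidableEq ι] extends LeviCivita F V where
  /-- the `f`-structure -/
  f : V →ₗ[F] V
  /-- the structure fields -/
  ξ : ι → V
  f_skew : ∀ X Y, g (f X) Y = -g X (f Y)
  f_sq : ∀ X, f (f X) = -X + ∑ α, g (ξ α) X • ξ α
  f_ξ : ∀ α, f (ξ α) = 0
  g_ξ_ξ : ∀ α β, g (ξ α) (ξ β) = if α = β then 1 else 0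
  contact : ∀ α X Y, g (D X (ξ α)) Y - g (D Y (ξ α)) X = 2 * g X (f Y)

namespace FContact

variable {F V ι : Type*} [CommRing F] [Algebra ℝ F] [AddCommGroup V] [Module F V]
    [Fintype ι] [DecidableEq ι] (S : FContact F V ι)

@[simp] theorem g_ξ_f (α : ι) (X : V) : S.g (S.ξ α) (S.f X) = 0 := by
  rw [← neg_eq_zero, ← S.f_skew, S.f_ξ, map_zero, LinearMap.zero_apply]

@[simp] theorem g_f_ξ (α : ι) (X : V) : S.g (S.f X) (S.ξ α) = 0 := by
  rw [S.g_symm, S.g_ξ_f]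

@[simp] theorem f_f_f (X : V) : S.f (S.f (S.f X)) = -S.f X := by
  rw [S.f_sq]; simp

theorem g_D_ξ_skew (X : V) (α β : ι) :
    S.g (S.D X (S.ξ α)) (S.ξ β) = -S.g (S.D X (S.ξ β)) (S.ξ α) := by
  have h := S.d_g X (S.ξ α) (S.ξ β)
  rw [S.g_ξ_ξ] at h
  have h0 : S.d X (if α = β then 1 else 0) = 0 := by split_ifs <;> simp
  rw [h0] at h
  linear_combination -h - S.g_symm (S.ξ α) (S.D X (S.ξ β))

/-- The fundamental `2`-form is closed. -/
theorem cyclic_covEnd_f [Nonempty ι] (X Y Z : V) :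
    S.g Y (S.covEnd S.f X Z) + S.g Z (S.covEnd S.f Y X) + S.g X (S.covEnd S.f Z Y) = 0 := by
  obtain ⟨α⟩ := ‹Nonempty ι›
  -- Differentiating the contact condition expresses `∇f` by second derivatives of `ξ_α`. In the
  -- cyclic sum these pair up to terms `R(·,·)ξ_α`, which cancel by the first Bianchi identity.
  have e : ∀ X Y Z, 2 * S.g Y (S.covEnd S.f X Z) =
      S.g (S.D X (S.D Y (S.ξ α)) - S.D (S.D X Y) (S.ξ α)) Z
      - S.g (S.D X (S.D Z (S.ξ α)) - S.D (S.D X Z) (S.ξ α)) Y := by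
    intro X Y Z
    have h := congrArg (S.d X) (S.contact α Y Z)
    have h2 : S.d X (2 * S.g Y (S.f Z)) = 2 * S.d X (S.g Y (S.f Z)) := by
      rw [two_mul, map_add, two_mul]
    rw [h2, map_sub] at h
    simp only [S.d_g] at h
    have h3 := S.contact α (S.D X Y) Z
    have h4 := S.contact α Y (S.D X Z)
    simp only [LeviCivita.covEnd_apply, map_sub, LinearMap.sub_apply]
    linear_combination -h + h3 + h4
  have b := congrArg (fun U ↦ S.g U (S.ξ α)) (S.bianchi_first X Y Z)
  simp only [map_add, LinearMap.add_apply, map_zero, LinearMap.zero_apply] at b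
  rw [S.g_R_skew, S.g_R_skew Y, S.g_R_skew Z] at b
  simp only [LeviCivita.R_apply] at b
  apply eq_zero_of_two_mul
  have e1 := e X Y Z
  have e2 := e Y Z X
  have e3 := e Z X Y
  simp only [map_sub, LinearMap.sub_apply, AddMonoidHom.sub_apply] at b e1 e2 e3 ⊢
  linear_combination -b + e1 + e2 + e3

theorem eq_zero_of_f_eq_zero {X : V} (h : S.f X = 0) (h' : ∀ α, S.g (S.ξ α) X = 0) : X = 0 := by
  have := S.f_sq X
  simpa [h, h'] using this

-- By `a` the field is skew in `α, β`. Closedness of the fundamental form on `ξ_α, ξ_β, Z` then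
-- removes its horizontal part. Its component along `ξ_γ` is skew in `α, β` and in `β, γ`, but
-- symmetric in `α, γ` by `c`, so it vanishes too.
@[simp] theorem D_ξ_ξ [Nonempty ι] (α β : ι) : S.D (S.ξ α) (S.ξ β) = 0 := by
  have c : ∀ α β Y, S.g (S.D (S.ξ α) (S.ξ β)) Y = S.g (S.D Y (S.ξ β)) (S.ξ α) := by
    intro α β Y
    have := S.contact β (S.ξ α) Y
    simp only [g_ξ_f] at this
    linear_combination this
  have a : ∀ α β Y, S.g (S.D (S.ξ α) (S.ξ β)) Y = -S.g (S.D (S.ξ β) (S.ξ α)) Y := by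
    intro α β Y
    rw [c, c, S.g_D_ξ_skew]
  apply S.eq_zero_of_f_eq_zero
  · apply S.ext_g
    intro Z
    rw [map_zero, LinearMap.zero_apply, S.f_skew]
    have h := S.cyclic_covEnd_f (S.ξ α) (S.ξ β) Z
    have h1 := S.d_g (S.ξ α) (S.ξ β) (S.f Z)
    rw [g_ξ_f, map_zero] at h1
    simp only [LeviCivita.covEnd_apply, S.f_ξ, map_sub, map_zero, g_ξ_f] at h
    have h2 := S.f_skew (S.D (S.ξ β) (S.ξ α)) Z
    rw [S.g_symm] at h2
    apply eq_zero_of_two_mul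
    linear_combination h + h1 + h2 - a α β (S.f Z)
  · intro γ
    rw [S.g_symm]
    apply eq_zero_of_two_mul
    have h1 := c α β (S.ξ γ)
    have h2 := a α β (S.ξ γ)
    have h3 := S.g_D_ξ_skew (S.ξ β) α γ
    have h4 := a β γ (S.ξ α)
    linear_combination h1 + h2 - h3 + h4

/-- The symmetric part of `∇ξ_α`. -/
def B (α : ι) : V →ₗ[F] V := S.grad (S.ξ α) + S.f

theorem D_ξ (α : ι) (X : V) : S.D X (S.ξ α) = S.B α X - S.f X := by
  simp [B]

theorem B_symm (α : ι) (X Y : V) : S.g (S.B α X) Y = S.g X (S.B α Y) := by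
  have h := S.contact α X Y
  simp only [S.D_ξ, map_sub, LinearMap.sub_apply] at h
  linear_combination h + S.f_skew X Y - S.g_symm (S.f Y) X - S.g_symm X (S.B α Y)

variable [Nonempty ι]

@[simp] theorem B_ξ (α β : ι) : S.B α (S.ξ β) = 0 := by
  have := S.D_ξ α (S.ξ β)
  simpa [S.f_ξ] using this.symm

@[simp] theorem g_B_ξ (α β : ι) (X : V) : S.g (S.B α X) (S.ξ β) = 0 := by
  rw [S.B_symm, B_ξ, map_zero]

@[simp] theorem g_ξ_B (α β : ι) (X : V) : S.g (S.ξ β) (S.B α X) = 0 := by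
  rw [S.g_symm, S.g_B_ξ]

theorem covEnd_f_ξ_aux (α : ι) (X : V) :
    S.covEnd S.f (S.ξ α) X = -S.f (S.B α X) - S.B α (S.f X) := by
  apply S.ext_g
  intro Y
  have h := S.cyclic_covEnd_f (S.ξ α) Y X
  have h1 := S.d_g Y (S.ξ α) (S.f X)
  have h2 := S.d_g X (S.ξ α) (S.f Y)
  rw [g_ξ_f, map_zero] at h1 h2
  simp only [LeviCivita.covEnd_apply, S.f_ξ, map_sub, map_neg, map_zero, g_ξ_f, S.D_ξ,
    LinearMap.sub_apply, LinearMap.neg_apply] at h h1 h2 ⊢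
  have e1 := S.f_skew (S.B α X) Y
  have e2 := S.B_symm α (S.f X) Y
  have e3 := S.g_symm (S.D (S.ξ α) (S.f X)) Y
  have e4 := S.g_symm (S.f (S.D (S.ξ α) X)) Y
  have e7 := S.f_skew X (S.B α Y)
  have e8 := S.f_skew X (S.f Y)
  linear_combination h + h2 + e1 + e2 + e3 - e4 + e7 - e8

/-- Since the `ξ_β` are parallel along `ξ_α`, so is `f²`; hence `∇_{ξ_α} f` anticommutes with `f`.
Inserting `covEnd_f_ξ_aux` gives `B = f B f`, and one more `f` gives the claim. -/
theorem f_B (α : ι) (X : V) : S.f (S.B α X) = -S.B α (S.f X) := by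
  have h : ∀ X, S.f (S.covEnd S.f (S.ξ α) X) + S.covEnd S.f (S.ξ α) (S.f X) = 0 := by
    intro X
    have e : ∀ β Y, S.d (S.ξ α) (S.g (S.ξ β) Y) = S.g (S.ξ β) (S.D (S.ξ α) Y) := by
      intro β Y
      simp [S.d_g]
    simp only [LeviCivita.covEnd_apply, S.f_sq, map_sub, map_add, map_neg, map_sum, S.D_smul,
      D_ξ_ξ, smul_zero, zero_add, e]
    simp
  have h1 := h X
  simp only [covEnd_f_ξ_aux, map_sub, map_neg, S.f_sq (S.B α X), S.f_sq X, map_add, map_sum,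
    map_smul, g_ξ_B, B_ξ, smul_zero, Finset.sum_const_zero, zero_smul, add_zero] at h1
  have h2 : S.f (S.B α (S.f X)) = S.B α X := by
    have h3 : ∀ Z, S.g (S.B α X - S.f (S.B α (S.f X))) Z = 0 := by
      intro Z
      apply eq_zero_of_two_mul
      have h4 := congrArg (fun U ↦ S.g U Z) h1
      simp only [map_sub, map_add, map_neg, LinearMap.sub_apply, LinearMap.add_apply,
        LinearMap.neg_apply, map_zero, LinearMap.zero_apply] at h4 ⊢
      linear_combination h4
    have h5 := S.g_definite _ (h3 _)
    exact (sub_eq_zero.1 h5).symm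
  rw [← h2, S.f_sq]
  simp

@[simp] theorem covEnd_f_ξ (α : ι) (X : V) : S.covEnd S.f (S.ξ α) X = 0 := by
  rw [covEnd_f_ξ_aux, f_B]; simp

theorem D_ξ_f (α : ι) (X : V) : S.D (S.ξ α) (S.f X) = S.f (S.D (S.ξ α) X) := by
  rw [← sub_eq_zero, ← LeviCivita.covEnd_apply, covEnd_f_ξ]

/-- The Lie derivative of `f` in the direction of `ξ_α`. -/
theorem lie_ξ_f (α : ι) (X : V) :
    S.D (S.ξ α) (S.f X) - S.D (S.f X) (S.ξ α) - S.f (S.D (S.ξ α) X - S.D X (S.ξ α))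
      = S.f (S.B α X) + S.f (S.B α X) := by
  simp only [D_ξ_f, map_sub, D_ξ, f_B]
  abel

end FContact
end Contact

/-! ### The nullity condition along the structure fields: all `B_α` coincide. -/

section Nullity

theorem eq_zero_of_two_smul (F : Type*) {V : Type*} [CommRing F] [Algebra ℝ F] [AddCommGroup V]
    [Module F V] {X : V} (h : (2 : F) • X = 0) : X = 0 := by
  have e : algebraMap ℝ F (1 / 2) * 2 = 1 := by
    rw [show (2 : F) = algebraMap ℝ F 2 from (map_ofNat _ 2).symm, ← map_mul]
    norm_num
  rw [← one_smul F X, ← e, mul_smul, h, smul_zero]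

namespace FContact

variable {F V ι : Type*} [CommRing F] [Algebra ℝ F] [AddCommGroup V] [Module F V]
    [Fintype ι] [DecidableEq ι] (S : FContact F V ι)

/-- `ξ̄ = ∑ ξ_α`. -/
def ξbar : V := ∑ α, S.ξ α

/-- `η̄ = ∑ η_α`. -/
def ηbar : V →ₗ[F] F := S.g S.ξbar

theorem ηbar_eq_sum (X : V) : S.ηbar X = ∑ α, S.g (S.ξ α) X := by
  simp [ηbar, ξbar]

theorem g_ξbar (X : V) : S.g S.ξbar X = S.ηbar X := rfl

theorem g_right_ξbar (X : V) : S.g X S.ξbar = S.ηbar X := S.g_symm _ _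

@[simp] theorem ηbar_ξ (α : ι) : S.ηbar (S.ξ α) = 1 := by
  simp [ηbar_eq_sum, S.g_ξ_ξ]

@[simp] theorem ηbar_f (X : V) : S.ηbar (S.f X) = 0 := by simp [ηbar_eq_sum]

end FContact

/-- The algebraic data of a metric `f`-`(κ,μ)` manifold. -/
structure FNullity (F V ι : Type*) [CommRing F] [Algebra ℝ F] [AddCommGroup V] [Module F V]
    [Fintype ι] [DecidableEq ι] extends FContact F V ι where
  /-- the constant `κ` -/
  κ : F
  /-- the constant `μ` -/
  μ : F
  d_κ : ∀ X, d X κ = 0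
  d_μ : ∀ X, d X μ = 0
  nullity : ∀ α X Y, toLeviCivita.R X Y (ξ α) =
    κ • (toFContact.ηbar X • f (f Y) - toFContact.ηbar Y • f (f X))
    + μ • (toFContact.ηbar Y • f (toFContact.B α X) - toFContact.ηbar X • f (toFContact.B α Y))

namespace FNullity

variable {F V ι : Type*} [CommRing F] [Algebra ℝ F] [AddCommGroup V] [Module F V]
    [Fintype ι] [DecidableEq ι] (S : FNullity F V ι) [Nonempty ι]

/-- This is the nullity condition for `R(X, ξ_β)ξ_α`, solved for the derivative of `B_α`. -/
theorem D_ξ_B_aux (α β : ι) (X : V) : S.D (S.ξ β) (S.B α X) = S.B α (S.D (S.ξ β) X)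
    - S.B α (S.B β X) + S.B α (S.f X) + S.f (S.B β X) - S.f (S.f X) + S.κ • S.f (S.f X)
    - S.μ • S.f (S.B α X) := by
  have h := S.nullity α X (S.ξ β)
  simp only [LeviCivita.R_apply, map_zero, map_sub, AddMonoidHom.sub_apply,
    S.f_ξ, FContact.ηbar_ξ, smul_zero, one_smul, FContact.B_ξ, S.D_ξ, S.D_ξ_f] at h
  rw [← sub_eq_zero] at h ⊢
  rw [← neg_eq_zero, ← h]
  module

/-- Apply `D_ξ_B_aux` to `f X`, apply `f` to it at `X`, and add: the derivative terms cancel because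
`B_α` anticommutes with `f` while `∇_{ξ_β}` commutes with it. Only the part of the equation
anticommuting with the derivative survives, namely the quadratic one. -/
theorem B_B (α β : ι) (X : V) : S.B α (S.B β X) = (S.κ - 1) • S.f (S.f X) := by
  have h1 := S.D_ξ_B_aux α β (S.f X)
  have h2 := congrArg S.f (S.D_ξ_B_aux α β X)
  have e : S.D (S.ξ β) (S.B α (S.f X)) = -S.f (S.D (S.ξ β) (S.B α X)) := by
    rw [← S.D_ξ_f, S.f_B, map_neg, neg_neg]
  have e1 : ∀ α X, S.B α (S.f X) = -S.f (S.B α X) := fun α X ↦ by rw [S.f_B, neg_neg]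
  have e2 : ∀ X, S.f (S.f (S.B α X)) = -S.B α X := fun X ↦ by simp [S.f_sq (S.B α X)]
  have e3 : S.f (S.f (S.B β X)) = -S.B β X := by simp [S.f_sq (S.B β X)]
  have e4 : S.B α (S.f (S.f X)) = -S.B α X := by simp [S.f_sq X]
  rw [e] at h1
  simp only [map_add, map_sub, map_smul, map_neg, e1, e2, e3, FContact.f_f_f, S.D_ξ_f] at h1 h2
  have h3 : S.f (S.B α (S.B β X)) = (S.κ - 1) • S.f (S.f (S.f X)) := by
    rw [← sub_eq_zero]
    apply eq_zero_of_two_smul F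
    rw [FContact.f_f_f]
    have h4 := congrArg₂ (· + ·) h1 h2
    rw [neg_add_cancel] at h4
    rw [← neg_eq_zero]
    refine Eq.trans ?_ h4.symm
    module
  have h4 := congrArg S.f h3
  rw [e2, map_smul, FContact.f_f_f, smul_neg] at h4
  exact neg_injective h4

/-- By symmetry `|(B_α - B_β)X|² = g(X, (B_α - B_β)² X)`, and the four products in the square are
equal by `B_B`. -/
theorem B_eq (α β : ι) : S.B α = S.B β := by
  ext X
  rw [← sub_eq_zero]
  apply S.g_definite
  have e : ∀ Y, S.g (S.B α X - S.B β X) Y = S.g X (S.B α Y - S.B β Y) := by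
    intro Y; simp [S.B_symm]
  rw [e]
  simp [B_B]

end FNullity
end Nullity

/-! ### Linear algebra of the horizontal parts of `∇f` and `∇b`. -/

section Trilinear

variable {F U : Type*} [CommRing F] [Algebra ℝ F] [AddCommGroup U] [Module F U]
  {J b : U →ₗ[F] U} {c c' : F} {P W : U →ₗ[F] U →ₗ[F] U →ₗ[F] F}

/-- The horizontal part of the covariant derivative of `f` vanishes. -/
theorem trilinear_eq_zero (hJ : ∀ X, J (J X) = -X) (hJb : ∀ X, b (J X) = -J (b X))
    (hb : ∀ X, b (b X) = c • X) (hc : c * c' = 1)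
    (hP : ∀ X Y Z, P X Y Z = -P X Z Y) (hPJ : ∀ X Y Z, P X (J Y) Z = P X Y (J Z))
    (hcyc : ∀ X Y Z, P X Y Z + P Y Z X + P Z X Y = 0)
    (hW : ∀ X Y Z, W X (b Y) Z = -W X Y (b Z))
    (hPW : ∀ X Y Z, P Z X Y = W Y X Z - W X Y Z) (X Y Z : U) : P X Y Z = 0 := by
  have hc0 : ∀ a : F, c * a = 0 → a = 0 := fun a h ↦ by linear_combination c' * h - a * hc
  -- This combination eliminates `W`: rewriting `P` by `hPW` and moving `b` across by `hW`, all
  -- terms cancel.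
  have e1 : ∀ X Y Z, c * (P (b Z) X Y + P Z (b X) Y + P Z X (b Y)) + P (b Z) (b X) (b Y) = 0 := by
    intro X Y Z
    simp only [hPW, hW, hb, map_smul, smul_eq_mul]
    ring
  -- Replacing `X, Y` by `J X, J Y` in `e1` flips the first and last terms and keeps the middle two;
  -- adding isolates these.
  have e2 : ∀ X Y Z, P Z (b X) Y = -P Z X (b Y) := by
    intro X Y Z
    rw [eq_neg_iff_add_eq_zero]
    apply hc0
    apply eq_zero_of_two_mul
    have h := e1 (J X) (J Y) Z
    simp only [hJb, hPJ, hJ, map_neg, LinearMap.neg_apply] at h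
    linear_combination e1 X Y Z + h
  have sskew : ∀ X Y Z, P X Y (J Z) = -P X Z (J Y) := by
    intro X Y Z; rw [← hPJ, hP]
  have sb : ∀ X Y Z, P X (b Y) (J Z) = P X Y (J (b Z)) := by
    intro X Y Z; rw [e2, hJb, map_neg, neg_neg]
  have C : ∀ X Y Z, P X Y (J Z) - P Y X (J Z) + P (J Z) X Y = 0 := by
    intro X Y Z
    linear_combination hcyc X Y (J Z) - hP Y (J Z) X
  have U1 : ∀ X Y Z, P (b X) Y (J Z) + P X (b Y) (J Z) = P (b Y) X (J Z) + P Y (b X) (J Z) := by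
    intro X Y Z
    linear_combination C (b X) Y Z + C X (b Y) Z - e2 X Y (J Z)
  have U2 : ∀ X Y Z, P (b X) Y (J Z) + P X (b Y) (J Z)
      = -(P (b X) Z (J Y) + P X (b Z) (J Y)) := by
    intro X Y Z
    linear_combination sskew (b X) Y Z + sb X Y Z + sskew X Y (b Z)
  -- The expression is symmetric in `X, Y` by `U1` and skew in `Y, Z` by `U2`, so it is zero.
  have U3 : ∀ X Y Z, P (b X) Y (J Z) + P X (b Y) (J Z) = 0 := by
    intro X Y Z
    apply eq_zero_of_two_mul
    linear_combination U1 X Y Z + U2 Y X Z - U1 Y Z X - U2 Z Y X + U1 Z X Y + U2 X Z Y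
  have S0 : ∀ X Y Z, P (b X) Y (J Z) = 0 := by
    intro X Y Z
    apply eq_zero_of_two_mul
    have h := U3 (J Z) X (J Y)
    simp only [hJ, hJb, map_neg, LinearMap.neg_apply] at h
    linear_combination C (b X) Y Z - C X Y (b Z) + U3 X Y Z + sb Y X Z - sb X Y Z + h
  apply hc0
  have h := S0 (b X) Y (J Z)
  simp only [hb, hJ, map_neg, map_smul, LinearMap.smul_apply, smul_eq_mul] at h
  linear_combination -h

/-- The horizontal part of the covariant derivative of `b` vanishes. -/
theorem trilinear_eq_zero_of_symm (hb : ∀ X, b (b X) = c • X) (hc : c * c' = 1)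
    (hWsymm : ∀ X Y Z, W X Y Z = W X Z Y) (hW : ∀ X Y Z, W X (b Y) Z = -W X Y (b Z))
    (hW' : ∀ X Y Z, W Y X Z = W X Y Z) (X Y Z : U) : W X Y Z = 0 := by
  have hc0 : ∀ a : F, c * a = 0 → a = 0 := fun a h ↦ by linear_combination c' * h - a * hc
  -- `W` is totally symmetric, and passing `b` from one slot to another changes the sign. Carrying
  -- `b` once round the three slots changes it three times.
  have h1 : ∀ X Y Z, W (b X) Y Z = 0 := by
    intro X Y Z
    apply eq_zero_of_two_mul
    linear_combination hW' Y (b X) Z + hW Y X Z - hW' X Y (b Z) + hW' Y (b X) Z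
      + hWsymm Y (b X) Z + hW' Z Y (b X) + hW Z Y X + hW' Z (b Y) X - hWsymm (b Y) Z X
      - hW' X (b Y) Z - hW X Y Z
  apply hc0
  have h := h1 (b X) Y Z
  simp only [hb, map_smul, LinearMap.smul_apply, smul_eq_mul] at h
  exact h
end Trilinear

/-! ### Kähler-like curvature tensors are determined by holomorphic sectional curvature. -/

section Kaehler

variable {F U : Type*} [CommRing F] [Algebra ℝ F] [AddCommGroup U]

/-- A Kähler-like algebraic curvature tensor with vanishing holomorphic sectional curvature
vanishes. -/
theorem kaehlerLike_eq_zero (J : U →+ U) (hJ : ∀ X, J (J X) = -X) (T : U → U → U → U → F)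
    (hadd : ∀ X X' Y Z W, T (X + X') Y Z W = T X Y Z W + T X' Y Z W)
    (hskew : ∀ X Y Z W, T Y X Z W = -T X Y Z W) (hpair : ∀ X Y Z W, T X Y Z W = T Z W X Y)
    (hB : ∀ X Y Z W, T X Y Z W + T Y Z X W + T Z X Y W = 0)
    (hTJ : ∀ X Y Z W, T X Y (J Z) (J W) = T X Y Z W)
    (hol : ∀ X, T X (J X) X (J X) = 0) (X Y Z W : U) : T X Y Z W = 0 := by
  have hadd2 : ∀ X Y Y' Z W, T X (Y + Y') Z W = T X Y Z W + T X Y' Z W := by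
    intro X Y Y' Z W
    rw [hskew, hadd, hskew X Y, hskew X Y']; ring
  have hadd3 : ∀ X Y Z Z' W, T X Y (Z + Z') W = T X Y Z W + T X Y Z' W := by
    intro X Y Z Z' W
    rw [hpair, hadd, hpair X Y, hpair X Y]
  have hadd4 : ∀ X Y Z W W', T X Y Z (W + W') = T X Y Z W + T X Y Z W' := by
    intro X Y Z W W'
    rw [hpair, hadd2, hpair X Y, hpair X Y]
  have hneg : ∀ X Y Z W, T (-X) Y Z W = -T X Y Z W := by
    intro X Y Z W
    have h0 := hadd 0 0 Y Z W
    have h := hadd X (-X) Y Z W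
    rw [add_neg_cancel] at h
    rw [add_zero] at h0
    linear_combination -h - h0
  have hneg2 : ∀ X Y Z W, T X (-Y) Z W = -T X Y Z W := by
    intro X Y Z W
    rw [hskew, hneg, hskew X Y, neg_neg]
  have hneg3 : ∀ X Y Z W, T X Y (-Z) W = -T X Y Z W := by
    intro X Y Z W
    rw [hpair, hneg, hpair X Y]
  have hneg4 : ∀ X Y Z W, T X Y Z (-W) = -T X Y Z W := by
    intro X Y Z W
    rw [hpair, hneg2, hpair X Y]
  have hskew2 : ∀ X Y Z W, T X Y W Z = -T X Y Z W := by
    intro X Y Z W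
    rw [hpair, hskew, hpair X Y]
  have sw2 : ∀ X Y Z W, T X Y W (J Z) = T X Y Z (J W) := by
    intro X Y Z W
    rw [← hTJ, hJ, hneg4, hskew2, neg_neg]
  have sw1 : ∀ X Y Z W, T Y (J X) Z W = T X (J Y) Z W := by
    intro X Y Z W
    rw [hpair, sw2, hpair]
  -- Polarisation: add the vanishing holomorphic curvatures of `X + Y` and `X - Y`.
  have h1 : ∀ X Y, T X (J X) Y (J Y) + 2 * T X (J Y) X (J Y) = 0 := by
    intro X Y
    have e1 := hol (X + Y)
    have e2 := hol (X + -Y)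
    simp only [map_add, map_neg, hadd, hadd2, hadd3, hadd4, hneg, hneg2, hneg3, hneg4, hol] at e1 e2
    have s1 := sw2 X (J Y) X Y
    have s2 := sw1 X Y X (J Y)
    have s3 := sw1 X Y Y (J X)
    have s4 := hpair Y (J Y) X (J X)
    apply eq_zero_of_ofNat_mul 4
    push_cast
    linear_combination e1 + e2 - 4 * s1 - 2 * s2 - 2 * s3 - 2 * s4
  have h2 : ∀ X Y, T X (J X) Y (J Y) = T X (J Y) X (J Y) + T X Y X Y := by
    intro X Y
    have e1 := hB X (J X) Y (J Y)
    have e2 := hTJ Y X X Y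
    have e3 : T (J X) Y X (J Y) = - T X (J Y) X (J Y) := by
      rw [hpair, ← hTJ, hJ, hneg3, hpair]
    linear_combination e1 - e2 - e3 - hskew X Y X Y
  -- With `a = T(X,Y,X,Y)` and `a' = T(X,JY,X,JY)`, comparing `h1` and `h2` gives `a + 3a' = 0`, and
  -- replacing `Y` by `J Y` gives `3a + a' = 0`; hence `8a = 0`.
  have h3 : ∀ X Y, T X Y X Y = 0 := by
    intro X Y
    have e1 := h1 X Y
    have e2 := h1 X (J Y)
    have e3 := h2 X Y
    have e4 := h2 X (J Y)
    simp only [hJ, hneg2, hneg4] at e2 e4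
    apply eq_zero_of_ofNat_mul 8
    push_cast
    linear_combination 3 * (e2 - e4) - (e1 - e3)
  have h4 : ∀ X Y Z, T X Y Z Y = 0 := by
    intro X Y Z
    have e := h3 (X + Z) Y
    simp only [hadd, hadd3, h3] at e
    apply eq_zero_of_two_mul
    linear_combination e + hpair X Y Z Y
  have h5 : ∀ X Y Z W, T X Y Z W = -T X W Z Y := by
    intro X Y Z W
    have e := h4 X (Y + W) Z
    simp only [hadd2, hadd4, h4] at e
    linear_combination e
  -- Skewness in the second and fourth slots makes the three terms of the Bianchi identity equal.
  apply eq_zero_of_ofNat_mul 3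
  push_cast
  linear_combination hB X Y Z W - 2 * hskew Z Y X W + 2 * hpair Z Y X W + 2 * h5 X Y Z W
    - hskew X Z Y W + hpair X Z Y W + h5 Y Z X W
end Kaehler

set_option linter.unusedSectionVars false

/-! ### Horizontal fields and the covariant derivatives of `f` and `b`. -/

section Nullity

namespace FContact

variable {F V ι : Type*} [CommRing F] [Algebra ℝ F] [AddCommGroup V] [Module F V]
    [Fintype ι] [DecidableEq ι] (S : FContact F V ι)

/-- The horizontal vector fields. -/
def hor : Submodule F V := ⨅ α, LinearMap.ker (S.g (S.ξ α))

theorem mem_hor {X : V} : X ∈ S.hor ↔ ∀ α, S.g (S.ξ α) X = 0 := by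
  simp [hor]

theorem f_mem_hor (X : V) : S.f X ∈ S.hor := S.mem_hor.2 (by simp)

theorem ηbar_hor {X : V} (hX : X ∈ S.hor) : S.ηbar X = 0 := by
  simp [ηbar_eq_sum, S.mem_hor.1 hX]

theorem f_f_hor {X : V} (hX : X ∈ S.hor) : S.f (S.f X) = -X := by
  simp [f_sq, S.mem_hor.1 hX]

theorem g_f_f (X Y : V) : S.g (S.f X) (S.f Y) = -S.g X (S.f (S.f Y)) := S.f_skew _ _

/-- Tensorial statements can be checked on horizontal fields and on the structure fields. -/
@[elab_as_elim]
theorem hor_induction {p : V → Prop} (X : V) (h : ∀ X ∈ S.hor, p X) (hξ : ∀ α, p (S.ξ α))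
    (hadd : ∀ X Y, p X → p Y → p (X + Y)) (hsmul : ∀ (a : F) X, p X → p (a • X)) : p X := by
  have e : X = -S.f (S.f X) + ∑ α, S.g (S.ξ α) X • S.ξ α := by rw [S.f_sq]; abel
  rw [e]
  refine hadd _ _ (h _ (S.hor.neg_mem (S.f_mem_hor _))) ?_
  refine Finset.sum_induction _ p hadd (h 0 S.hor.zero_mem) fun α _ ↦ hsmul _ _ (hξ α)

theorem g_covEnd_f_skew (X Y Z : V) :
    S.g (S.covEnd S.f X Y) Z = -S.g (S.covEnd S.f X Z) Y := by
  have h := congrArg (S.d X) (S.f_skew Y Z)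
  rw [map_neg] at h
  simp only [S.d_g] at h
  simp only [LeviCivita.covEnd_apply, map_sub, LinearMap.sub_apply]
  linear_combination h - S.f_skew (S.D X Y) Z - S.f_skew (S.D X Z) Y + S.g_symm (S.D X (S.f Z)) Y
    - S.g_symm (S.f Y) (S.D X Z)

theorem g_covEnd_f_f {Y Z : V} (hY : Y ∈ S.hor) (hZ : Z ∈ S.hor) (X : V) :
    S.g (S.covEnd S.f X (S.f Y)) Z = S.g (S.covEnd S.f X Y) (S.f Z) := by
  simp only [LeviCivita.covEnd_apply, map_sub, LinearMap.sub_apply, S.f_skew, S.f_f_hor hY,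
    S.f_f_hor hZ, map_neg, LinearMap.neg_apply]
  ring

end FContact

namespace FNullity

variable {F V ι : Type*} [CommRing F] [Algebra ℝ F] [AddCommGroup V] [Module F V]
    [Fintype ι] [DecidableEq ι] (S : FNullity F V ι) [Nonempty ι]

/-- The common symmetric part of the endomorphisms `∇ξ_α`. -/
def b : V →ₗ[F] V := S.B (Classical.arbitrary ι)

theorem B_eq_b (α : ι) : S.B α = S.b := S.B_eq _ _

/-- The number of structure fields, as a function. -/
def s (_ : FNullity F V ι) : F := (Fintype.card ι : F)

theorem grad_ξ (α : ι) (X : V) : S.D X (S.ξ α) = S.b X - S.f X := by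
  rw [S.D_ξ, S.B_eq_b]

/-- The common value of the endomorphisms `∇ξ_α`. -/
def A : V →ₗ[F] V := S.b - S.f

/-- The endomorphism `f ∘ ∇ξ_α`, which is `I + h` on horizontal fields. -/
def E : V →ₗ[F] V := S.f ∘ₗ S.A

/-- The endomorphism which describes the covariant derivative of `b`. -/
def N : V →ₗ[F] V := S.f ∘ₗ S.b + (S.κ - 1) • S.f ∘ₗ S.f

theorem A_apply (X : V) : S.A X = S.b X - S.f X := rfl

theorem E_apply (X : V) : S.E X = S.f (S.b X) - S.f (S.f X) := by simp [E, A]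

theorem N_apply (X : V) : S.N X = S.f (S.b X) + (S.κ - 1) • S.f (S.f X) := by simp [N]

theorem b_symm (X Y : V) : S.g (S.b X) Y = S.g X (S.b Y) := S.B_symm _ _ _

@[simp] theorem b_ξ (α : ι) : S.b (S.ξ α) = 0 := S.B_ξ _ _

@[simp] theorem g_b_ξ (α : ι) (X : V) : S.g (S.b X) (S.ξ α) = 0 := S.g_B_ξ _ _ _

@[simp] theorem g_ξ_b (α : ι) (X : V) : S.g (S.ξ α) (S.b X) = 0 := S.g_ξ_B _ _ _

@[simp] theorem ηbar_b (X : V) : S.ηbar (S.b X) = 0 := by simp [FContact.ηbar_eq_sum]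

theorem b_f (X : V) : S.b (S.f X) = -S.f (S.b X) := by
  rw [b, S.f_B, neg_neg]

@[simp] theorem f_f_b (X : V) : S.f (S.f (S.b X)) = -S.b X := by simp [S.f_sq (S.b X)]

theorem b_b (X : V) : S.b (S.b X) = (S.κ - 1) • S.f (S.f X) := S.B_B _ _ _

theorem b_mem_hor (X : V) : S.b X ∈ S.hor := S.mem_hor.2 (by simp)

theorem b_b_hor {X : V} (hX : X ∈ S.hor) : S.b (S.b X) = (1 - S.κ) • X := by
  rw [b_b, S.f_f_hor hX]; module

/-- Once `b² = (κ - 1) f²` and `b f = -f b` are known, every correction in `D_ξ_B_aux` cancels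
except the one with `μ`. -/
theorem D_ξ_b (α : ι) (X : V) :
    S.D (S.ξ α) (S.b X) = S.b (S.D (S.ξ α) X) - S.μ • S.f (S.b X) := by
  have h := S.D_ξ_B_aux α α X
  simp only [B_eq_b, b_b, b_f] at h
  rw [h]
  module

theorem D_ξbar (X : V) : S.D X S.ξbar = S.s • S.A X := by
  simp [A_apply, FContact.ξbar, S.grad_ξ, s, Nat.cast_smul_eq_nsmul, smul_sub]

theorem d_ηbar (X Y : V) :
    S.d X (S.ηbar Y) = S.ηbar (S.D X Y) + S.s * S.g (S.A X) Y := by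
  simp only [FContact.ηbar, S.d_g, D_ξbar, map_smul, LinearMap.smul_apply, smul_eq_mul]
  ring

theorem g_covEnd_b_symm (X Y Z : V) :
    S.g (S.covEnd S.b X Y) Z = S.g (S.covEnd S.b X Z) Y := by
  have h := congrArg (S.d X) (S.b_symm Y Z)
  simp only [S.d_g] at h
  simp only [LeviCivita.covEnd_apply, map_sub, LinearMap.sub_apply]
  linear_combination h - S.b_symm (S.D X Y) Z + S.b_symm (S.D X Z) Y - S.g_symm (S.D X (S.b Z)) Y
    - S.g_symm (S.b Y) (S.D X Z)

theorem g_covEnd_b_b {Y Z : V} (hY : Y ∈ S.hor) (hZ : Z ∈ S.hor) (X : V) :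
    S.g (S.covEnd S.b X (S.b Y)) Z = -S.g (S.covEnd S.b X Y) (S.b Z) := by
  simp only [LeviCivita.covEnd_apply, map_sub, LinearMap.sub_apply, S.b_symm, S.b_b_hor hY,
    S.b_b_hor hZ, map_smul, S.D_smul, S.d_κ, zero_smul, add_zero,
    LinearMap.smul_apply, sub_self, Derivation.map_one_eq_zero]
  ring

theorem nullity_hor {X Y : V} (hX : X ∈ S.hor) (hY : Y ∈ S.hor) (α : ι) :
    S.R X Y (S.ξ α) = 0 := by
  simp [S.nullity, S.ηbar_hor hX, S.ηbar_hor hY]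

/-- The Codazzi equation: the left side is `R(X, Y)ξ_α` expanded through `∇ξ_α = b - f`, and nullity
makes it zero on horizontal fields. -/
theorem covEnd_b_sub_covEnd_f {X Y : V} (hX : X ∈ S.hor) (hY : Y ∈ S.hor) :
    S.covEnd S.b X Y - S.covEnd S.f X Y - (S.covEnd S.b Y X - S.covEnd S.f Y X) = 0 := by
  rw [← S.nullity_hor hX hY (Classical.arbitrary ι)]
  simp only [LeviCivita.R_apply, grad_ξ, LeviCivita.covEnd_apply, map_sub,
    AddMonoidHom.sub_apply]
  abel

/-- The restriction of the trilinear form `g((∇_X T)Y, Z)` to horizontal fields. -/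
def horForm (T : V →ₗ[F] V) : S.hor →ₗ[F] S.hor →ₗ[F] S.hor →ₗ[F] F :=
  LinearMap.mk₂ F (fun X Y ↦ (S.g (S.covEnd T X Y)).domRestrict S.hor)
    (fun X X' Y ↦ by ext; simp) (fun a X Y ↦ by ext; simp)
    (fun X Y Y' ↦ by ext; simp) (fun a X Y ↦ by ext; simp)

theorem horForm_apply (T : V →ₗ[F] V) (X Y Z : S.hor) :
    S.horForm T X Y Z = S.g (S.covEnd T X Y) Z := rfl

theorem horForm_f_eq (X Y Z : S.hor) :
    S.horForm S.f Z X Y = S.horForm S.b Y X Z - S.horForm S.b X Y Z := by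
  have h := congrArg (fun U ↦ S.g U Z) (S.covEnd_b_sub_covEnd_f X.2 Y.2)
  simp only [map_sub, LinearMap.sub_apply, map_zero, LinearMap.zero_apply] at h
  have h1 := S.cyclic_covEnd_f X Y Z
  simp only [S.g_symm _ (S.covEnd _ _ _)] at h1
  simp only [horForm_apply]
  linear_combination -h1 + h + S.g_covEnd_f_skew Z X Y + S.g_covEnd_f_skew X Y Z

/-- Either `κ ≠ 1`, or the endomorphisms `∇ξ_α` are skew-symmetric. -/
def Regular : Prop := (∃ c, (1 - S.κ) * c = 1) ∨ S.b = 0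

/-- If `1 - κ` is invertible, the two trilinear lemmas apply, first to `∇f` and then to `∇b`, which
has become totally symmetric. If `b = 0`, the form of `∇b` is trivially zero and `horForm_f_eq`
gives that of `∇f`. -/
theorem horForm_eq_zero (h : S.Regular) :
    (∀ X Y Z, S.horForm S.f X Y Z = 0) ∧ ∀ X Y Z, S.horForm S.b X Y Z = 0 := by
  obtain ⟨c, hc⟩ | h := h
  · have h1 : ∀ X Y Z, S.horForm S.f X Y Z = 0 := by
      refine trilinear_eq_zero (J := S.f.restrict fun X _ ↦ S.f_mem_hor X)
        (b := S.b.restrict fun X _ ↦ S.b_mem_hor X) (c := 1 - S.κ) (c' := c) (W := S.horForm S.b)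
        ?_ ?_ ?_ hc ?_ ?_ ?_ ?_ ?_
      · exact fun X ↦ Subtype.ext (S.f_f_hor X.2)
      · exact fun X ↦ Subtype.ext (S.b_f X)
      · exact fun X ↦ Subtype.ext (S.b_b_hor X.2)
      · exact fun X Y Z ↦ S.g_covEnd_f_skew X Y Z
      · exact fun X Y Z ↦ S.g_covEnd_f_f Y.2 Z.2 X
      · intro X Y Z
        have h1 := S.cyclic_covEnd_f X Y Z
        simp only [S.g_symm _ (S.covEnd _ _ _)] at h1
        simp only [horForm_apply]
        linear_combination -h1 + S.g_covEnd_f_skew X Y Z + S.g_covEnd_f_skew Y Z X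
          + S.g_covEnd_f_skew Z X Y
      · exact fun X Y Z ↦ S.g_covEnd_b_b Y.2 Z.2 X
      · exact S.horForm_f_eq
    refine ⟨h1, trilinear_eq_zero_of_symm (b := S.b.restrict fun X _ ↦ S.b_mem_hor X)
      (c := 1 - S.κ) (c' := c) (fun X ↦ Subtype.ext (S.b_b_hor X.2)) hc
      (fun X Y Z ↦ S.g_covEnd_b_symm X Y Z) (fun X Y Z ↦ S.g_covEnd_b_b Y.2 Z.2 X) ?_⟩
    intro X Y Z
    have := S.horForm_f_eq X Y Z
    rw [h1] at this
    linear_combination -this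
  · have h1 : ∀ X Y Z, S.horForm S.b X Y Z = 0 := by
      intro X Y Z
      simp [horForm_apply, LeviCivita.covEnd_apply, h]
    exact ⟨fun X Y Z ↦ by rw [horForm_f_eq, h1, h1, sub_zero], h1⟩

/-- The all-horizontal part vanishes, `X = ξ_α` gives zero, and `Y = ξ_α` or `Z = ξ_α` is computed
from `f ξ_α = 0` and skewness. -/
theorem covEnd_f (h : S.Regular) (X Y : V) : S.covEnd S.f X Y =
    S.g Y (S.E X) • S.ξbar - S.ηbar Y • S.E X := by
  rw [E_apply]
  have hξ : ∀ α X, S.covEnd S.f X (S.ξ α) = S.f (S.f X) - S.f (S.b X) := by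
    intro α X
    simp [LeviCivita.covEnd_apply, S.f_ξ, S.grad_ξ]
  apply S.ext_g
  intro Z
  refine S.hor_induction Z (fun Z hZ ↦ ?_) (fun α ↦ ?_) ?_ ?_
  · refine S.hor_induction Y (fun Y hY ↦ ?_) (fun α ↦ ?_) ?_ ?_
    · refine S.hor_induction X (fun X hX ↦ ?_) (fun α ↦ ?_) ?_ ?_
      · have e := (S.horForm_eq_zero h).1 ⟨X, hX⟩ ⟨Y, hY⟩ ⟨Z, hZ⟩
        rw [horForm_apply] at e
        simp [e, S.ηbar_hor hY, S.ηbar_hor hZ, FContact.g_ξbar]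
      · simp [S.f_ξ]
      · intro X X' h h'
        simp only [map_add, LinearMap.add_apply, h, h', map_sub, LinearMap.sub_apply, map_smul,
          LinearMap.smul_apply, smul_eq_mul]
        ring
      · intro a X h
        simp only [map_smul, LinearMap.smul_apply, h, map_sub, LinearMap.sub_apply, smul_eq_mul]
        ring
    · simp [hξ]
    · intro X X' h h'
      simp only [map_add, LinearMap.add_apply, h, h', map_sub, LinearMap.sub_apply, map_smul,
          LinearMap.smul_apply, smul_eq_mul]
      ring
    · intro a X h
      simp only [map_smul, LinearMap.smul_apply, h, map_sub, LinearMap.sub_apply, smul_eq_mul]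
      ring
  · rw [S.g_covEnd_f_skew, hξ]
    simp [FContact.g_ξbar, S.g_symm Y]
  · intro X X' h h'
    rw [map_add, h, h']
    exact (map_add _ _ _).symm
  · intro a X h
    rw [map_smul, h]
    exact (map_smul _ _ _).symm

/-- Same decomposition as for `f`, with symmetry in place of skewness; the term with `μ` comes from
`D_ξ_b`. -/
theorem covEnd_b (h : S.Regular) (X Y : V) : S.covEnd S.b X Y =
    -(S.g Y (S.N X) • S.ξbar + S.ηbar Y • S.N X + (S.μ * S.ηbar X) • S.f (S.b Y)) := by
  rw [N_apply]
  have hξ : ∀ α X, S.covEnd S.b X (S.ξ α) = -(S.f (S.b X) + (S.κ - 1) • S.f (S.f X)) := by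
    intro α X
    simp only [LeviCivita.covEnd_apply, b_ξ, map_zero, grad_ξ, map_sub, b_b, b_f]
    abel
  apply S.ext_g
  intro Z
  refine S.hor_induction Z (fun Z hZ ↦ ?_) (fun α ↦ ?_) ?_ ?_
  · refine S.hor_induction Y (fun Y hY ↦ ?_) (fun α ↦ ?_) ?_ ?_
    · refine S.hor_induction X (fun X hX ↦ ?_) (fun α ↦ ?_) ?_ ?_
      · have e := (S.horForm_eq_zero h).2 ⟨X, hX⟩ ⟨Y, hY⟩ ⟨Z, hZ⟩
        rw [horForm_apply] at e
        simp [e, S.ηbar_hor hX, S.ηbar_hor hY, S.ηbar_hor hZ, FContact.g_ξbar]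
      · simp [S.f_ξ, LeviCivita.covEnd_apply, D_ξ_b]
      · intro X X' h h'
        simp only [map_add, LinearMap.add_apply, h, h', map_smul, map_neg, LinearMap.neg_apply,
          LinearMap.smul_apply, smul_eq_mul]
        ring
      · intro a X h
        simp only [map_smul, LinearMap.smul_apply, h, map_add, LinearMap.add_apply, map_neg,
          LinearMap.neg_apply, smul_eq_mul]
        ring
    · simp [hξ]
    · intro X X' h h'
      simp only [map_add, LinearMap.add_apply, h, h', map_neg, LinearMap.neg_apply, map_smul,
          LinearMap.smul_apply, smul_eq_mul]
      ring
    · intro a X h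
      simp only [map_smul, LinearMap.smul_apply, h, map_add, LinearMap.add_apply, map_neg,
        LinearMap.neg_apply, smul_eq_mul]
      ring
  · rw [S.g_covEnd_b_symm, hξ]
    simp [FContact.g_ξbar, S.g_symm Y]
  · intro X X' h h'
    rw [map_add, h, h']
    exact (map_add _ _ _).symm
  · intro a X h
    rw [map_smul, h]
    exact (map_smul _ _ _).symm

end FNullity
end Nullity

/-! ### The curvature tensor for given `f`-sectional curvature. -/

section SpaceForm

namespace FNullity

variable {F V ι : Type*} [CommRing F] [Algebra ℝ F] [AddCommGroup V] [Module F V]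
    [Fintype ι] [DecidableEq ι] (S : FNullity F V ι) [Nonempty ι]

theorem D_f (h : S.Regular) (X Y : V) :
    S.D X (S.f Y) = S.f (S.D X Y) + (S.g Y (S.E X) • S.ξbar - S.ηbar Y • S.E X) := by
  rw [← S.covEnd_f h, LeviCivita.covEnd_apply]; abel

theorem D_b (h : S.Regular) (X Y : V) : S.D X (S.b Y) = S.b (S.D X Y)
    - (S.g Y (S.N X) • S.ξbar + S.ηbar Y • S.N X + (S.μ * S.ηbar X) • S.f (S.b Y)) := by
  rw [sub_eq_add_neg, ← S.covEnd_b h, LeviCivita.covEnd_apply]; abel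

theorem ηbar_D {Y : V} (hY : Y ∈ S.hor) (X : V) : S.ηbar (S.D X Y) = -(S.s * S.g (S.A X) Y) := by
  have h := S.d_ηbar X Y
  rw [S.ηbar_hor hY, map_zero] at h
  linear_combination -h

/-- The commutator of the curvature with `f`. -/
theorem curvature_f (h : S.Regular) {Z W : V} (hZ : Z ∈ S.hor) (hW : W ∈ S.hor) (X Y : V) :
    S.g (S.R X Y (S.f Z)) W + S.g (S.R X Y Z) (S.f W) =
      S.s * (S.g Z (S.E Y) * S.g (S.A X) W - S.g (S.A X) Z * S.g (S.E Y) W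
        - S.g Z (S.E X) * S.g (S.A Y) W + S.g (S.A Y) Z * S.g (S.E X) W) := by
  -- Commuting two derivatives past `f` produces vertical terms. Against horizontal `W`, what
  -- remains comes from `∇ξ̄ = s A` and from `η̄(∇Z)`.
  simp only [LeviCivita.R_apply, S.D_f h, S.ηbar_hor hZ, map_add, map_sub, zero_smul, sub_zero, AddMonoidHom.sub_apply,
    S.D_smul, D_ξbar, LinearMap.add_apply, LinearMap.sub_apply, map_smul, LinearMap.smul_apply,
    smul_eq_mul, FContact.g_ξbar, S.ηbar_hor hW, S.ηbar_D hZ, S.f_skew]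
  ring

/-- The commutator of the curvature with `b`. -/
theorem curvature_b (h : S.Regular) {X Y Z W : V} (hX : X ∈ S.hor) (hY : Y ∈ S.hor)
    (hZ : Z ∈ S.hor) (hW : W ∈ S.hor) :
    S.g (S.R X Y (S.b Z)) W - S.g (S.R X Y Z) (S.b W) =
      S.s * (S.g (S.A Y) Z * S.g (S.N X) W - S.g Z (S.N Y) * S.g (S.A X) W
        - S.g (S.A X) Z * S.g (S.N Y) W + S.g Z (S.N X) * S.g (S.A Y) W
        - S.μ * (S.g (S.A X) Y - S.g (S.A Y) X) * S.g (S.f (S.b Z)) W) := by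
  simp only [LeviCivita.R_apply, S.D_b h, S.ηbar_hor hZ, S.ηbar_hor hX, S.ηbar_hor hY, map_add,
    map_sub, zero_smul, mul_zero, add_zero, AddMonoidHom.sub_apply,
    S.D_smul, D_ξbar, LinearMap.add_apply, LinearMap.sub_apply, map_smul, LinearMap.smul_apply,
    smul_eq_mul, FContact.g_ξbar, S.ηbar_hor hW, S.ηbar_D hZ, S.ηbar_D hX, S.ηbar_D hY, S.b_symm]
  ring

theorem E_hor {X : V} (hX : X ∈ S.hor) : S.E X = S.f (S.b X) + X := by
  rw [E_apply, S.f_f_hor hX, sub_neg_eq_add]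

theorem g_f_swap (X Y : V) : S.g Y (S.f X) = -S.g X (S.f Y) := by
  rw [S.g_symm, S.f_skew]

theorem g_b_swap (X Y : V) : S.g Y (S.b X) = S.g X (S.b Y) := by
  rw [S.g_symm, S.b_symm]

theorem g_f_b_swap (X Y : V) : S.g Y (S.f (S.b X)) = S.g X (S.f (S.b Y)) := by
  rw [S.g_symm, S.f_skew, S.b_symm, S.b_f, map_neg, neg_neg]

/-- The right-hand side of the formula for the curvature tensor. -/
def curvatureForm (H : F) (X Y Z W : V) : F :=
  (H + 3 * S.s) * (S.g (S.f (S.f Y)) Z * S.g (S.f (S.f X)) W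
      - S.g (S.f (S.f X)) Z * S.g (S.f (S.f Y)) W)
  + (H - S.s) * (2 * S.g (S.f Y) X * S.g (S.f Z) W + S.g X (S.f Z) * S.g (S.f Y) W
      - S.g Y (S.f Z) * S.g (S.f X) W)
  - 2 * S.s * (S.g (S.f (S.b X)) Z * S.g (S.f (S.b Y)) W
      - S.g (S.f (S.b Y)) Z * S.g (S.f (S.b X)) W
      - S.g (S.b X) Z * S.g (S.b Y) W + S.g (S.b Y) Z * S.g (S.b X) W
      - 2 * S.g (S.f (S.f X)) Z * S.g (S.f (S.b Y)) W
      + 2 * S.g (S.f (S.f Y)) Z * S.g (S.f (S.b X)) W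
      - 2 * S.g (S.f (S.b X)) Z * S.g (S.f (S.f Y)) W
      + 2 * S.g (S.f (S.b Y)) Z * S.g (S.f (S.f X)) W)
  + 4 * S.κ * (S.ηbar X * S.ηbar Z * S.g (S.f (S.f Y)) W
      - S.ηbar X * S.g Y (S.f (S.f Z)) * S.ηbar W
      - S.ηbar Y * S.ηbar Z * S.g (S.f (S.f X)) W + S.ηbar Y * S.g X (S.f (S.f Z)) * S.ηbar W)
  + 4 * S.μ * (S.ηbar Y * S.ηbar Z * S.g (S.f (S.b X)) W
      - S.ηbar Y * S.g X (S.f (S.b Z)) * S.ηbar W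
      - S.ηbar X * S.ηbar Z * S.g (S.f (S.b Y)) W + S.ηbar X * S.g Y (S.f (S.b Z)) * S.ηbar W)

theorem curvatureForm_hor (H : F) {X Y Z W : V} (hX : X ∈ S.hor) (hY : Y ∈ S.hor)
    (hZ : Z ∈ S.hor) : S.curvatureForm H X Y Z W =
      (H + 3 * S.s) * (S.g Y Z * S.g X W - S.g X Z * S.g Y W)
      + (H - S.s) * (-2 * S.g X (S.f Y) * S.g Z (S.f W)
        - S.g X (S.f Z) * S.g Y (S.f W) + S.g Y (S.f Z) * S.g X (S.f W))
      - 2 * S.s * (S.g X (S.f (S.b Z)) * S.g Y (S.f (S.b W))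
        - S.g Y (S.f (S.b Z)) * S.g X (S.f (S.b W))
        - S.g X (S.b Z) * S.g Y (S.b W) + S.g Y (S.b Z) * S.g X (S.b W)
        + 2 * S.g X Z * S.g Y (S.f (S.b W)) - 2 * S.g Y Z * S.g X (S.f (S.b W))
        + 2 * S.g X (S.f (S.b Z)) * S.g Y W - 2 * S.g Y (S.f (S.b Z)) * S.g X W) := by
  simp only [curvatureForm, S.ηbar_hor hX, S.ηbar_hor hY, S.f_f_hor hX, S.f_f_hor hY,
    S.f_f_hor hZ, S.f_skew, S.b_symm, S.b_f, map_neg, LinearMap.neg_apply, S.g_f_swap X Y]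
  ring

/-- The curvature tensor on horizontal fields, if the `f`-sectional curvature is `H`. -/
theorem curvature_hor (h : S.Regular) (H : F)
    (hH : ∀ X ∈ S.hor, S.g (S.R X (S.f X) (S.f X)) X = H * S.g X X ^ 2)
    {X Y Z W : V} (hX : X ∈ S.hor) (hY : Y ∈ S.hor) (hZ : Z ∈ S.hor) (hW : W ∈ S.hor) :
    4 * S.g (S.R X Y Z) W = S.curvatureForm H X Y Z W := by
  -- The difference of the two sides is shown to be Kähler-like with zero holomorphic sectional
  -- curvature.
  have key := kaehlerLike_eq_zero (S.f.restrict fun X (_ : X ∈ S.hor) ↦ S.f_mem_hor X).toAddMonoidHom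
    (fun X ↦ Subtype.ext (S.f_f_hor X.2))
    (fun X Y Z W ↦ 4 * S.g (S.R X Y Z) W - S.curvatureForm H X Y Z W)
    ?_ ?_ ?_ ?_ ?_ ?_ ⟨X, hX⟩ ⟨Y, hY⟩ ⟨Z, hZ⟩ ⟨W, hW⟩
  · exact sub_eq_zero.1 key
  · rintro X X' Y Z W
    simp only [curvatureForm, Submodule.coe_add, map_add, LinearMap.add_apply]
    ring
  · rintro ⟨X, hX⟩ ⟨Y, hY⟩ ⟨Z, hZ⟩ ⟨W, hW⟩
    simp only [S.R_antisymm X Y, S.curvatureForm_hor H hX hY hZ, S.curvatureForm_hor H hY hX hZ,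
      S.g_f_swap X Y, map_neg, LinearMap.neg_apply]
    ring
  · rintro ⟨X, hX⟩ ⟨Y, hY⟩ ⟨Z, hZ⟩ ⟨W, hW⟩
    simp only [S.curvatureForm_hor H hX hY hZ, S.curvatureForm_hor H hZ hW hX, S.g_R_pair Z W,
      S.g_symm Z X, S.g_symm Z Y, S.g_symm W X, S.g_symm W Y,
      S.g_f_swap X Z, S.g_f_swap X W, S.g_f_swap Y Z, S.g_f_swap Y W, S.g_b_swap X Z, S.g_b_swap X W,
      S.g_b_swap Y Z, S.g_b_swap Y W, S.g_f_b_swap X Z, S.g_f_b_swap X W, S.g_f_b_swap Y Z,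
      S.g_f_b_swap Y W]
    ring
  · rintro ⟨X, hX⟩ ⟨Y, hY⟩ ⟨Z, hZ⟩ ⟨W, hW⟩
    have e := congrArg (fun U ↦ S.g U W) (S.bianchi_first X Y Z)
    simp only [map_add, LinearMap.add_apply, map_zero, LinearMap.zero_apply] at e
    simp only [S.curvatureForm_hor H hX hY hZ, S.curvatureForm_hor H hY hZ hX,
      S.curvatureForm_hor H hZ hX hY,
      S.g_symm Y X, S.g_symm Z X, S.g_symm Z Y, S.g_f_swap X Y, S.g_f_swap X Z, S.g_f_swap Y Z,
      S.g_b_swap X Y, S.g_b_swap X Z, S.g_b_swap Y Z, S.g_f_b_swap X Y, S.g_f_b_swap X Z,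
      S.g_f_b_swap Y Z]
    linear_combination 4 * e
  -- Invariance under `f`: neither side is invariant by itself, but both fail by the same amount,
  -- which `curvature_f` computes.
  · rintro ⟨X, hX⟩ ⟨Y, hY⟩ ⟨Z, hZ⟩ ⟨W, hW⟩
    have e := S.curvature_f h hZ (S.f_mem_hor W) X Y
    simp only [S.f_f_hor hW, map_neg, A_apply, S.E_hor hX, S.E_hor hY, map_add, map_sub,
      LinearMap.sub_apply, LinearMap.add_apply, S.b_symm, S.f_skew, S.b_f, neg_neg,
      S.g_symm Z X, S.g_symm Z Y, S.g_f_b_swap X Z, S.g_f_b_swap Y Z] at e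
    simp only [LinearMap.coe_restrict_apply, LinearMap.toAddMonoidHom_coe,
      S.curvatureForm_hor H hX hY hZ, S.curvatureForm_hor H hX hY (S.f_mem_hor Z),
      S.f_f_hor hZ, S.f_f_hor hW, S.b_f, f_f_b, map_neg, neg_neg, S.f_skew]
    linear_combination 4 * e
  · rintro ⟨X, hX⟩
    have e := hH X hX
    rw [S.g_R_skew] at e
    simp only [LinearMap.coe_restrict_apply, LinearMap.toAddMonoidHom_coe,
      S.curvatureForm_hor H hX (S.f_mem_hor X) hX, S.f_f_hor hX, S.b_f, f_f_b, map_neg, neg_neg]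
    have e1 : S.g X (S.f X) = 0 := by
      apply eq_zero_of_two_mul
      linear_combination S.g_f_swap X X
    simp only [e1, S.g_symm (S.f X) X, S.g_f_swap X (S.f X), S.f_f_hor hX, S.f_skew, f_f_b,
      map_neg, neg_neg]
    linear_combination -4 * e

/-- The curvature tensor, if the `f`-sectional curvature is `H`. -/
theorem curvature_eq (h : S.Regular) (H : F)
    (hH : ∀ X ∈ S.hor, S.g (S.R X (S.f X) (S.f X)) X = H * S.g X X ^ 2) (X Y Z W : V) :
    4 * S.g (S.R X Y Z) W = S.curvatureForm H X Y Z W := by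
  -- The curvature symmetries move a structure field from any slot into the third one, where nullity
  -- prescribes the value.
  have hξ : ∀ α X Y W, 4 * S.g (S.R X Y (S.ξ α)) W = 4 * S.κ * (S.ηbar X * S.g (S.f (S.f Y)) W
      - S.ηbar Y * S.g (S.f (S.f X)) W) + 4 * S.μ * (S.ηbar Y * S.g (S.f (S.b X)) W
      - S.ηbar X * S.g (S.f (S.b Y)) W) := by
    intro α X Y W
    rw [S.nullity]
    simp only [B_eq_b, map_add, map_sub, map_smul, LinearMap.add_apply, LinearMap.sub_apply,
      LinearMap.smul_apply, smul_eq_mul]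
    ring
  have hff : ∀ X Y, S.g Y (S.f (S.f X)) = S.g X (S.f (S.f Y)) := by
    intro X Y
    rw [S.g_symm, S.f_skew, S.f_skew, neg_neg]
  refine S.hor_induction W (fun W hW ↦ ?_) (fun α ↦ ?_) ?_ ?_
  · refine S.hor_induction Z (fun Z hZ ↦ ?_) (fun α ↦ ?_) ?_ ?_
    · refine S.hor_induction Y (fun Y hY ↦ ?_) (fun α ↦ ?_) ?_ ?_
      · refine S.hor_induction X (fun X hX ↦ ?_) (fun α ↦ ?_) ?_ ?_
        · exact S.curvature_hor h H hH hX hY hZ hW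
        · rw [S.g_R_pair, hξ]
          simp [curvatureForm, S.f_ξ, S.ηbar_hor hZ, S.ηbar_hor hW]
        · intro X X' e e'
          rw [map_add, LinearMap.add_apply, LinearMap.add_apply, map_add, LinearMap.add_apply,
            mul_add, e, e']
          simp only [curvatureForm, map_add, LinearMap.add_apply]
          ring
        · intro a X e
          rw [map_smul, LinearMap.smul_apply, LinearMap.smul_apply, map_smul,
            LinearMap.smul_apply, smul_eq_mul, mul_left_comm, e]
          simp only [curvatureForm, map_smul, LinearMap.smul_apply, smul_eq_mul]
          ring
      · rw [S.g_R_pair, S.g_R_skew, mul_neg, hξ]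
        simp [curvatureForm, S.f_ξ, S.ηbar_hor hZ, S.ηbar_hor hW]
      · intro Y Y' e e'
        rw [map_add, LinearMap.add_apply, map_add, LinearMap.add_apply, mul_add, e, e']
        simp only [curvatureForm, map_add, LinearMap.add_apply]
        ring
      · intro a Y e
        rw [map_smul, LinearMap.smul_apply, map_smul, LinearMap.smul_apply, smul_eq_mul,
          mul_left_comm, e]
        simp only [curvatureForm, map_smul, LinearMap.smul_apply, smul_eq_mul]
        ring
    · rw [hξ]
      simp [curvatureForm, S.f_ξ, S.ηbar_hor hW]
    · intro Z Z' e e'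
      rw [map_add, map_add, LinearMap.add_apply, mul_add, e, e']
      simp only [curvatureForm, map_add, LinearMap.add_apply]
      ring
    · intro a Z e
      rw [map_smul, map_smul, LinearMap.smul_apply, smul_eq_mul, mul_left_comm, e]
      simp only [curvatureForm, map_smul, LinearMap.smul_apply, smul_eq_mul]
      ring
  · rw [S.g_R_skew, mul_neg, hξ]
    simp only [curvatureForm, FContact.g_f_ξ, g_b_ξ, FContact.ηbar_ξ, S.g_symm _ Z, hff Y Z, hff X Z,
      S.g_f_b_swap Y Z, S.g_f_b_swap X Z]
    ring
  · intro W W' e e'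
    rw [map_add, mul_add, e, e']
    simp only [curvatureForm, map_add]
    ring
  · intro a W e
    rw [map_smul, smul_eq_mul, mul_left_comm, e]
    simp only [curvatureForm, map_smul, smul_eq_mul]
    ring

end FNullity
end SpaceForm

/-! ### Equations for `H` and `μ` from eigenfields, and the Schur argument. -/

section Constancy

namespace FNullity

variable {F V ι : Type*} [CommRing F] [Algebra ℝ F] [AddCommGroup V] [Module F V]
    [Fintype ι] [DecidableEq ι] (S : FNullity F V ι) [Nonempty ι]

theorem g_f_self (X : V) : S.g X (S.f X) = 0 := by
  apply eq_zero_of_two_mul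
  linear_combination S.g_f_swap X X

theorem g_f_f_hor {X : V} (hX : X ∈ S.hor) (Y : V) : S.g (S.f X) (S.f Y) = S.g X Y := by
  rw [← neg_neg (S.g (S.f X) (S.f Y)), ← S.g_f_swap, S.f_f_hor hX, map_neg, neg_neg, S.g_symm]

theorem N_eigen {c : F} (hc : c * c = 1 - S.κ) {X : V} (hX : X ∈ S.hor) (hb : S.b X = c • X) :
    S.N X = c • (S.f X + c • X) := by
  rw [N_apply, hb, S.f_f_hor hX, map_smul, smul_add, smul_smul, hc]
  module

theorem N_f_eigen {c : F} (hc : c * c = 1 - S.κ) {X : V} (hX : X ∈ S.hor) (hb : S.b X = c • X) :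
    S.N (S.f X) = c • (X + c • S.f X) := by
  rw [N_apply, S.b_f, hb, map_smul, map_neg, map_smul, FContact.f_f_f, S.f_f_hor hX, smul_add,
    smul_smul, hc]
  module

/-- If `b` has an eigenfield, then the `f`-sectional curvature is determined by `κ` and `μ`. -/
theorem sectional_of_eigen (h : S.Regular) {H c : F} (hc : c * c = 1 - S.κ)
    {X : V} (hX : X ∈ S.hor) (hb : S.b X = c • X)
    (hH : S.g (S.R X (S.f X) (S.f X)) X = H * S.g X X ^ 2) :
    c * (H + S.s * (S.κ + S.μ)) * S.g X X ^ 2 = 0 := by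
  -- Since `b (f X) = -c • f X`, the left side of the commutator is `2c g(R(X, fX)X, fX)`, which
  -- `hH` evaluates.
  have e := S.curvature_b h hX (S.f_mem_hor X) hX (S.f_mem_hor X)
  rw [S.g_R_skew] at hH
  have e1 := S.g_f_self X
  have e2 := S.g_f_f_hor hX X
  have e3 : S.g (S.f X) X = 0 := by rw [S.g_symm, e1]
  simp only [S.N_eigen hc hX hb, S.N_f_eigen hc hX hb, A_apply, S.b_f, hb, map_smul, map_neg,
    map_add, map_sub, LinearMap.smul_apply, LinearMap.add_apply, LinearMap.sub_apply,
    LinearMap.neg_apply, smul_eq_mul, e1, e2, e3, S.f_f_hor hX] at e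
  apply eq_zero_of_two_mul
  linear_combination -e - 2 * c * hH + 2 * c * S.s * S.g X X ^ 2 * hc

/-- If `b` has two orthogonal eigenfields, then `μ` is determined by `κ`. -/
theorem sectional_of_eigen_orthogonal (h : S.Regular) {H c : F} (hc : c * c = 1 - S.κ)
    {X Y : V} (hX : X ∈ S.hor) (hY : Y ∈ S.hor) (hbX : S.b X = c • X) (hbY : S.b Y = c • Y)
    (hXY : S.g X Y = 0) (hXfY : S.g X (S.f Y) = 0)
    (hH : ∀ X ∈ S.hor, S.g (S.R X (S.f X) (S.f X)) X = H * S.g X X ^ 2) :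
    c * (H - S.s + 2 * S.s * S.μ) * (S.g X X * S.g Y Y) = 0 := by
  -- The commutator with `b` and the curvature formula both evaluate `g(R(X, fX)Y, fY)`; comparing
  -- them gives the second equation.
  have e := S.curvature_b h hX (S.f_mem_hor X) hY (S.f_mem_hor Y)
  have e' := S.curvature_eq h H hH X (S.f X) Y (S.f Y)
  have e1 := S.g_f_self X
  have e2 := S.g_f_f_hor hX X
  have e4 := S.g_f_f_hor hY Y
  have e5 := S.g_f_f_hor hX Y
  have e3 : S.g (S.f X) X = 0 := by rw [S.g_symm, e1]
  have e6 : S.g (S.f X) Y = 0 := by rw [S.f_skew, hXfY, neg_zero]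
  have e7 : S.g Y X = 0 := by rw [S.g_symm, hXY]
  have e8 : S.g Y (S.f X) = 0 := by rw [S.g_symm, e6]
  simp only [S.N_eigen hc hX hbX, S.N_f_eigen hc hX hbX, A_apply, S.b_f, hbX, hbY, map_smul, map_neg,
    map_add, map_sub, LinearMap.smul_apply, LinearMap.add_apply, LinearMap.sub_apply,
    LinearMap.neg_apply, smul_eq_mul, e1, e2, e3, e4, e5, e6, e7, e8, hXY, hXfY,
    S.f_f_hor hX] at e
  simp only [curvatureForm, S.ηbar_hor hX, S.ηbar_hor hY, FContact.ηbar_f, S.b_f, hbX, hbY,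
    map_smul, map_neg, LinearMap.smul_apply,
    LinearMap.neg_apply, smul_eq_mul, e4, e5, e6, hXY, hXfY,
    S.f_f_hor hX, S.f_f_hor hY] at e'
  apply eq_zero_of_two_mul
  linear_combination c * e' - 2 * e

section Schur

variable {S} (hb : S.b = 0)

include hb

theorem covR_hor {H : F} (hH : ∀ X ∈ S.hor, S.g (S.R X (S.f X) (S.f X)) X = H * S.g X X ^ 2)
    {Y Z W U : V} (hY : Y ∈ S.hor) (hZ : Z ∈ S.hor) (hW : W ∈ S.hor) (hU : U ∈ S.hor) (X : V) :
    4 * S.g (S.covR X Y Z W) U = S.d X H * (S.g Z W * S.g Y U - S.g Y W * S.g Z U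
      - 2 * S.g Y (S.f Z) * S.g W (S.f U) - S.g Y (S.f W) * S.g Z (S.f U)
      + S.g Z (S.f W) * S.g Y (S.f U)) := by
  have h : S.Regular := Or.inr hb
  have hs : S.d X S.s = 0 := Derivation.map_natCast _ _
  have e := S.curvature_hor h H hH hY hZ hW hU
  -- The numerical coefficients are written as repeated sums, so that additivity and the Leibniz
  -- rule suffice to differentiate.
  have e0 : S.g (S.R Y Z W) U + S.g (S.R Y Z W) U + S.g (S.R Y Z W) U + S.g (S.R Y Z W) U
      = H * (S.g Z W * S.g Y U - S.g Y W * S.g Z U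
        - S.g Y (S.f Z) * S.g W (S.f U) - S.g Y (S.f Z) * S.g W (S.f U)
        - S.g Y (S.f W) * S.g Z (S.f U) + S.g Z (S.f W) * S.g Y (S.f U))
      + S.s * (S.g Z W * S.g Y U - S.g Y W * S.g Z U + S.g Z W * S.g Y U - S.g Y W * S.g Z U
        + S.g Z W * S.g Y U - S.g Y W * S.g Z U
        + S.g Y (S.f Z) * S.g W (S.f U) + S.g Y (S.f Z) * S.g W (S.f U)
        + S.g Y (S.f W) * S.g Z (S.f U) - S.g Z (S.f W) * S.g Y (S.f U)) := by
    rw [S.curvatureForm_hor H hY hZ hW] at e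
    simp only [hb, LinearMap.zero_apply, map_zero] at e
    linear_combination e
  replace e0 := congrArg (S.d X) e0
  simp only [map_add, map_sub, Derivation.leibniz, smul_eq_mul, hs, S.d_g, S.D_f h, S.ηbar_hor hY,
    S.ηbar_hor hZ, S.ηbar_hor hW, S.ηbar_hor hU, map_smul, zero_smul, FContact.g_right_ξbar,
    mul_zero, sub_zero, add_zero] at e0
  rw [S.g_covR, S.d_g]
  have e1 := S.curvature_eq h H hH (S.D X Y) Z W U
  have e2 := S.curvature_eq h H hH Y (S.D X Z) W U
  have e3 := S.curvature_eq h H hH Y Z (S.D X W) U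
  have e4 := S.curvature_eq h H hH Y Z W (S.D X U)
  simp only [curvatureForm, hb, LinearMap.zero_apply, map_zero, S.f_f_hor hY, S.f_f_hor hZ,
    S.f_f_hor hW, S.f_f_hor hU, S.ηbar_hor hY, S.ηbar_hor hZ, S.ηbar_hor hW, S.ηbar_hor hU,
    S.f_skew, map_neg, LinearMap.neg_apply, S.g_f_swap Y (S.D X Z), S.g_f_swap Y Z,
    S.g_f_swap (S.D X Y) Z] at e1 e2 e3 e4
  linear_combination e0 - e1 - e2 - e3 - e4

/-- Schur's argument: in the second Bianchi identity for `X, Y, fY`, evaluated on `fY` and `Y`,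
orthogonality kills the terms with `dH(Y)` and `dH(fY)`. -/
theorem d_hor_eq_zero {H : F}
    (hH : ∀ X ∈ S.hor, S.g (S.R X (S.f X) (S.f X)) X = H * S.g X X ^ 2) {X Y : V} (hX : X ∈ S.hor)
    (hY : Y ∈ S.hor) (hXY : S.g X Y = 0) (hXfY : S.g X (S.f Y) = 0) :
    S.d X H * S.g Y Y ^ 2 = 0 := by
  have hfY := S.f_mem_hor Y
  have h := congrArg (fun U ↦ S.g U Y) (S.bianchi_second X Y (S.f Y) (S.f Y))
  simp only [map_add, LinearMap.add_apply, map_zero, LinearMap.zero_apply] at h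
  have e1 := covR_hor hb hH hY hfY hfY hY X
  have e2 := covR_hor hb hH hfY hX hfY hY Y
  have e3 := covR_hor hb hH hX hY hfY hY (S.f Y)
  have e4 := S.g_f_f_hor hY Y
  have e5 := S.g_f_self Y
  simp only [e4, e5, hXY, hXfY, S.f_f_hor hY, map_neg, S.g_symm (S.f Y) Y,
    S.g_f_swap X (S.f Y)] at e1 e2 e3
  apply eq_zero_of_ofNat_mul 4
  push_cast
  linear_combination 4 * h - e1 - e2 - e3

theorem d_ξ_eq_zero (hκ : S.κ = 1) {H : F}
    (hH : ∀ X ∈ S.hor, S.g (S.R X (S.f X) (S.f X)) X = H * S.g X X ^ 2) {Y : V}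
    (hY : Y ∈ S.hor) (α : ι) : S.d (S.ξ α) H * S.g Y Y ^ 2 = 0 := by
  have hR : S.Regular := Or.inr hb
  have hfY := S.f_mem_hor Y
  have h := congrArg (fun U ↦ S.g U Y) (S.bianchi_second (S.ξ α) Y (S.f Y) (S.f Y))
  simp only [map_add, LinearMap.add_apply, map_zero, LinearMap.zero_apply] at h
  have e1 := covR_hor hb hH hY hfY hfY hY (S.ξ α)
  have c := S.curvature_eq hR H hH
  -- On horizontal arguments `g(R(Z, ξ_α)W, U)` is zero, so its covariant derivative only sees `∇_X
  -- ξ_α = -fX` and the vertical parts of `∇_X W` and `∇_X U`. In both uses below the result is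
  -- zero.
  have c1 : ∀ X Z W U, Z ∈ S.hor → W ∈ S.hor → U ∈ S.hor → 4 * S.g (S.covR X Z (S.ξ α) W) U =
      4 * S.g (S.R Z (S.f X) W) U - 4 * S.s * S.g (S.f X) W * S.g Z U
        + 4 * S.s * S.g (S.f X) U * S.g Z W := by
    intro X Z W U hZ hW hU
    have z0 := c Z (S.ξ α) W U
    have z1 := c (S.D X Z) (S.ξ α) W U
    have z2 := c Z (S.ξ α) (S.D X W) U
    have z3 := c Z (S.ξ α) W (S.D X U)
    simp only [curvatureForm, hb, LinearMap.zero_apply, map_zero, S.f_f_hor hZ,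
      S.f_f_hor hW, S.ηbar_hor hZ, S.ηbar_hor hW, S.ηbar_hor hU, S.ηbar_D hW,
      S.ηbar_D hU, S.f_ξ, FContact.ηbar_ξ, A_apply, map_neg,
      LinearMap.neg_apply, FContact.g_ξ_f, hκ, zero_sub] at z0 z1 z2 z3
    have z4 : S.g (S.R Z (S.ξ α) W) U = 0 := by
      apply eq_zero_of_ofNat_mul 4
      push_cast
      linear_combination z0
    have z5 : S.D X (S.ξ α) = -S.f X := by rw [S.grad_ξ, hb]; simp
    rw [S.g_covR, z4, map_zero, z5]
    simp only [map_neg, LinearMap.neg_apply]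
    linear_combination -z1 - z2 - z3
  have e2 := c1 Y (S.f Y) (S.f Y) Y hfY hfY hY
  have e3 := c1 (S.f Y) Y (S.f Y) Y hY hfY hY
  have e4 := S.g_f_f_hor hY Y
  have e5 := S.g_f_self Y
  have e6 : ∀ X Z, S.R X X Z = 0 := fun X Z ↦ by simp [LeviCivita.R_apply]
  have e7 : S.covR (S.f Y) (S.ξ α) Y (S.f Y) = -S.covR (S.f Y) Y (S.ξ α) (S.f Y) := by
    simp only [LeviCivita.covR, S.R_antisymm (S.ξ α), map_neg,
      S.R_antisymm (S.D (S.f Y) (S.ξ α))]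
    abel
  rw [e7] at h
  simp only [e4, e5, e6, S.f_f_hor hY, map_neg, S.g_symm (S.f Y) Y, LinearMap.neg_apply, map_zero,
    LinearMap.zero_apply] at e1 e2 e3 h
  apply eq_zero_of_ofNat_mul 4
  push_cast
  linear_combination 4 * h - e1 - e2 + e3

end Schur

end FNullity
end Constancy

/-! ### Smooth functions and fields on `M` as a ring and a module. -/

section Smooth

variable {E : Type*} [NormedAddCommGroup E] [NormedSpace ℝ E]
  {M : Type*} [TopologicalSpace M] [ChartedSpace E M] [IsManifold 𝓘(ℝ, E) ∞ M]

variable (E M) in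
/-- The algebra of smooth functions. -/
def smoothFun : Subalgebra ℝ (M → ℝ) where
  carrier := {φ | ContMDiff 𝓘(ℝ, E) 𝓘(ℝ, ℝ) ∞ φ}
  mul_mem' := fun hφ hψ ↦ ContMDiff.mul hφ hψ
  add_mem' := fun hφ hψ ↦ ContMDiff.add hφ hψ
  algebraMap_mem' := fun _ ↦ contMDiff_const

theorem smoothFun_mdiffAt (φ : smoothFun E M) (p : M) : MDiffAt φ.1 p :=
  (φ.2 p).mdifferentiableAt (by simp)

variable (E M) in
/-- The module of smooth vector fields. -/
def smoothVF : Submodule (smoothFun E M) (VField E M) where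
  carrier := {X | IsSmoothVF X}
  zero_mem' := Bundle.contMDiff_zeroSection _ _
  add_mem' := fun hX hY ↦ ContMDiff.add_section hX hY
  smul_mem' := fun φ _ hX ↦ ContMDiff.smul_section φ.2 hX

instance : CommRing (smoothFun E M) := inferInstance

instance : Algebra ℝ (smoothFun E M) := inferInstance

instance : AddCommGroup (smoothVF E M) := inferInstance

instance : Module (smoothFun E M) (smoothVF E M) := Submodule.module _

instance : SMul (smoothFun E M) (smoothVF E M) :=
  (Submodule.module (smoothVF E M)).toSMul

theorem smoothVF_mdiffAt (X : smoothVF E M) (p : M) : MDiffAt (T% X.1) p :=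
  IsSmoothVF.mdiffAt X.2 p

theorem smoothVF_smul_apply (φ : smoothFun E M) (X : smoothVF E M) (p : M) :
    (φ • X).1 p = φ.1 p • X.1 p := rfl

theorem ip_smooth (g : Metric E M) (X Y : smoothVF E M) :
    ContMDiff 𝓘(ℝ, E) 𝓘(ℝ, ℝ) ∞ (g.ip X.1 Y.1) := by
  have h := ContMDiff.clm_bundle_apply₂ (IM := 𝓘(ℝ, E)) (IB := 𝓘(ℝ, E)) (b := id)
    (F₁ := E) (F₂ := E) (F₃ := ℝ) (E₁ := (TangentSpace 𝓘(ℝ, E) : M → Type _))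
    (E₂ := (TangentSpace 𝓘(ℝ, E) : M → Type _)) (E₃ := Bundle.Trivial M ℝ)
    (ψ := g.inner) (v := X.1) (w := Y.1) g.contMDiff X.2 Y.2
  intro p
  exact ((Bundle.contMDiffAt_totalSpace ..).1 (h p)).2

@[simp] theorem smoothFun_add_apply (φ ψ : smoothFun E M) (p : M) :
    (φ + ψ).1 p = φ.1 p + ψ.1 p := rfl

@[simp] theorem smoothFun_mul_apply (φ ψ : smoothFun E M) (p : M) :
    (φ * ψ).1 p = φ.1 p * ψ.1 p := rfl

@[simp] theorem smoothVF_add_apply (X Y : smoothVF E M) (p : M) :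
    (X + Y).1 p = X.1 p + Y.1 p := rfl

/-- The metric as a bilinear form on smooth vector fields. -/
def Metric.form (g : Metric E M) : smoothVF E M →ₗ[smoothFun E M] smoothVF E M →ₗ[smoothFun E M]
    smoothFun E M :=
  LinearMap.mk₂ _ (fun X Y ↦ ⟨g.ip X.1 Y.1, ip_smooth g X Y⟩)
    (fun X X' Y ↦ by ext p; simp [Metric.ip])
    (fun a X Y ↦ by
      ext p
      change g.inner p (a.1 p • X.1 p) (Y.1 p) = a.1 p * g.inner p (X.1 p) (Y.1 p)
      simp)
    (fun X Y Y' ↦ by ext p; simp [Metric.ip])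
    (fun a X Y ↦ by
      ext p
      change g.inner p (X.1 p) (a.1 p • Y.1 p) = a.1 p * g.inner p (X.1 p) (Y.1 p)
      simp)

theorem Metric.form_apply (g : Metric E M) (X Y : smoothVF E M) (p : M) :
    (g.form X Y).1 p = g.inner p (X.1 p) (Y.1 p) := rfl

theorem Metric.form_symm (g : Metric E M) (X Y : smoothVF E M) : g.form X Y = g.form Y X := by
  ext p
  exact g.symm p _ _

theorem Metric.eq_zero_of_inner_self (g : Metric E M) {p : M} {v : TangentSpace 𝓘(ℝ, E) p}
    (h : g.inner p v v = 0) : v = 0 := by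
  by_contra hne
  exact (g.pos p v hne).ne' h

theorem Metric.form_definite (g : Metric E M) (X : smoothVF E M) (h : g.form X X = 0) : X = 0 := by
  ext p
  exact g.eq_zero_of_inner_self (congrFun (congrArg Subtype.val h) p)

theorem isManifold_minSmoothness (n : ℕ) :
    IsManifold 𝓘(ℝ, E) (minSmoothness ℝ n) M := by
  simp only [minSmoothness_of_isRCLikeNormedField]
  exact IsManifold.of_le (n := ∞) (by exact_mod_cast (le_top : (n : ℕ∞) ≤ ⊤))

variable [FiniteDimensional ℝ E]

theorem bracket_smooth (X Y : smoothVF E M) : IsSmoothVF (bracket X.1 Y.1) := by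
  have : IsManifold 𝓘(ℝ, E) (minSmoothness ℝ 2) M := isManifold_minSmoothness 2
  have : CompleteSpace E := FiniteDimensional.complete ℝ E
  have : IsManifold 𝓘(ℝ, E) (((⊤ : ℕ∞) : ℕ∞ω) + 1) M := ‹IsManifold 𝓘(ℝ, E) ∞ M›
  intro p
  exact ContMDiffAt.mlieBracket_vectorField (n := ⊤) (m := ⊤) (X.2 p) (Y.2 p) (by simp)

/-- The Lie bracket of smooth vector fields. -/
def lie (X Y : smoothVF E M) : smoothVF E M := ⟨bracket X.1 Y.1, bracket_smooth X Y⟩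

theorem lie_add_right (X Y Z : smoothVF E M) : lie X (Y + Z) = lie X Y + lie X Z := by
  have : CompleteSpace E := FiniteDimensional.complete ℝ E
  have : IsManifold 𝓘(ℝ, E) (minSmoothness ℝ 2) M := isManifold_minSmoothness 2
  ext p
  exact VectorField.mlieBracket_add_right (smoothVF_mdiffAt Y p) (smoothVF_mdiffAt Z p)

theorem lie_swap (X Y : smoothVF E M) : lie X Y = -lie Y X := by
  ext p
  exact VectorField.mlieBracket_swap_apply

theorem lie_add_left (X Y Z : smoothVF E M) : lie (X + Y) Z = lie X Z + lie Y Z := by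
  rw [lie_swap, lie_add_right, lie_swap Z X, lie_swap Z Y]
  abel

theorem lie_lie (X Y Z : smoothVF E M) : lie X (lie Y Z) = lie (lie X Y) Z + lie Y (lie X Z) := by
  have : CompleteSpace E := FiniteDimensional.complete ℝ E
  have : IsManifold 𝓘(ℝ, E) (minSmoothness ℝ 3) M := isManifold_minSmoothness 3
  have h2 : ∀ X : smoothVF E M, CMDiff (minSmoothness ℝ 2) (T% X.1) := fun X ↦ by
    simp only [minSmoothness_of_isRCLikeNormedField]
    exact ContMDiff.of_le X.2 ENat.LEInfty.out
  have := VectorField.leibniz_identity_mlieBracket (h2 X) (h2 Y) (h2 Z)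
  exact Subtype.ext this

theorem bracket_smul (X Y : smoothVF E M) (a : smoothFun E M) (p : M) :
    (lie X (a • Y)).1 p = dirDeriv X.1 a.1 p • Y.1 p + a.1 p • (lie X Y).1 p := by
  have : CompleteSpace E := FiniteDimensional.complete ℝ E
  have : IsManifold 𝓘(ℝ, E) (minSmoothness ℝ 2) M := isManifold_minSmoothness 2
  exact VectorField.mlieBracket_smul_right (smoothFun_mdiffAt a p) (smoothVF_mdiffAt Y p)

section UnitField

variable (g : Metric E M) (he : ∃ e : smoothVF E M, g.form e e = 1)
include he

/-- A unit field `e` reduces this to smoothness of brackets: `X(a) = g([X, a e] - a [X, e], e)`. On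
the manifolds at hand `ξ_1` serves as `e`. -/
theorem dirDeriv_smooth (X : smoothVF E M) (a : smoothFun E M) :
    ContMDiff 𝓘(ℝ, E) 𝓘(ℝ, ℝ) ∞ (dirDeriv X.1 a.1) := by
  obtain ⟨e, he⟩ := he
  have : dirDeriv X.1 a.1 = (g.form (lie X (a • e) - a • lie X e) e).1 := by
    ext p
    have h1 : g.inner p (e.1 p) (e.1 p) = 1 := congrFun (congrArg Subtype.val he) p
    rw [Metric.form_apply]
    change _ = g.inner p ((lie X (a • e)).1 p - a.1 p • (lie X e).1 p) (e.1 p)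
    rw [bracket_smul, add_sub_cancel_right]
    simp [h1]
  rw [this]
  exact (g.form _ e).2

/-- The action of smooth vector fields on smooth functions. -/
def vfDeriv : smoothVF E M →ₗ[smoothFun E M] Derivation ℝ (smoothFun E M) (smoothFun E M) where
  toFun X := Derivation.mk'
    { toFun := fun a ↦ ⟨dirDeriv X.1 a.1, dirDeriv_smooth g he X a⟩
      map_add' := fun a b ↦ by
        ext p
        change mvfderiv 𝓘(ℝ, E) (a.1 + b.1) p (X.1 p) = _
        rw [mvfderiv_add (smoothFun_mdiffAt a p) (smoothFun_mdiffAt b p)]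
        rfl
      map_smul' := fun c a ↦ by
        ext p
        change mvfderiv 𝓘(ℝ, E) ((fun _ ↦ c) * a.1) p (X.1 p) = _
        rw [mvfderiv_mul mdifferentiableAt_const (smoothFun_mdiffAt a p), mvfderiv_const]
        simp [dirDeriv] }
    (fun a b ↦ by
      ext p
      change mvfderiv 𝓘(ℝ, E) (a.1 * b.1) p (X.1 p) = _
      rw [mvfderiv_mul (smoothFun_mdiffAt a p) (smoothFun_mdiffAt b p)]
      rfl)
  map_add' X Y := by
    ext a p
    exact map_add (mvfderiv 𝓘(ℝ, E) a.1 p) _ _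
  map_smul' a X := by
    ext b p
    exact map_smul (mvfderiv 𝓘(ℝ, E) b.1 p) (a.1 p) (X.1 p)

theorem lie_smul_right (X Y : smoothVF E M) (a : smoothFun E M) :
    lie X (a • Y) = vfDeriv g he X a • Y + a • lie X Y := by
  ext p
  exact bracket_smul X Y a p

/-- Compare the Jacobi identities for `X, Y, a e` and `X, Y, e`; what is left is the claim times the
unit field `e`. -/
theorem vfDeriv_lie (X Y : smoothVF E M) (a : smoothFun E M) :
    vfDeriv g he (lie X Y) a
      = vfDeriv g he X (vfDeriv g he Y a) - vfDeriv g he Y (vfDeriv g he X a) := by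
  have he0 := he
  obtain ⟨e, he1⟩ := he0
  have h := lie_lie X Y (a • e)
  have h' := lie_lie X Y e
  simp only [lie_smul_right g he, lie_add_right] at h
  rw [h'] at h
  have h2 : vfDeriv g he (lie X Y) a • e
      = (vfDeriv g he X (vfDeriv g he Y a) - vfDeriv g he Y (vfDeriv g he X a)) • e := by
    rw [← sub_eq_zero] at h ⊢
    rw [← neg_eq_zero, ← h]
    module
  have h3 := congrArg (fun W ↦ g.form W e) h2
  simp only [map_smul, LinearMap.smul_apply, he1, smul_eq_mul, mul_one] at h3
  exact h3

end UnitField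

end Smooth

/-! ### Smoothness and axioms of the Levi-Civita connection. -/

section Connection

variable {E : Type*} [NormedAddCommGroup E] [NormedSpace ℝ E] [FiniteDimensional ℝ E]
  {M : Type*} [TopologicalSpace M] [T2Space M] [ChartedSpace E M] [IsManifold 𝓘(ℝ, E) ∞ M]
  (g : Metric E M)

/-- Evaluation of smooth functions at a point. -/
def evalAt (p : M) : smoothFun E M →+* ℝ where
  toFun φ := φ.1 p
  map_one' := rfl
  map_mul' _ _ := rfl
  map_zero' := rfl
  map_add' _ _ := rfl

theorem smoothVF_sum_apply {ι : Type*} (t : Finset ι) (X : ι → smoothVF E M) (p : M) :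
    (∑ i ∈ t, X i).1 p = ∑ i ∈ t, (X i).1 p := by
  classical
  induction t using Finset.induction_on with
  | empty => rfl
  | insert a t ha ih => rw [Finset.sum_insert ha, Finset.sum_insert ha, smoothVF_add_apply, ih]

theorem vecMul_gram {ι : Type*} [Fintype ι] [DecidableEq ι] (X : ι → smoothVF E M) (p : M) (c : ι → ℝ) (j : ι) :
    Matrix.vecMul c ((evalAt p).mapMatrix (Matrix.of fun i j ↦ g.form (X i) (X j))) j
      = g.inner p (∑ i, c i • (X i).1 p) ((X j).1 p) := by
  simp [Matrix.vecMul, dotProduct, evalAt, Metric.form_apply]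

/-- A vector field is smooth if its inner products with smooth vector fields are smooth. -/
theorem isSmoothVF_of_inner {V : VField E M}
    (h : ∀ Z : smoothVF E M, ContMDiff 𝓘(ℝ, E) 𝓘(ℝ, ℝ) ∞ (g.ip V Z.1)) : IsSmoothVF V := by
  intro p
  let n := Module.finrank ℝ E
  have : FiniteDimensional ℝ (TangentSpace 𝓘(ℝ, E) p) := inferInstanceAs (FiniteDimensional ℝ E)
  let b : Module.Basis (Fin n) ℝ (TangentSpace 𝓘(ℝ, E) p) := Module.finBasis ℝ E
  choose X hX hXp using fun i ↦ exists_isSmoothVF (b i)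
  let X' : Fin n → smoothVF E M := fun i ↦ ⟨X i, hX i⟩
  let G : Matrix (Fin n) (Fin n) (smoothFun E M) := Matrix.of fun i j ↦ g.form (X' i) (X' j)
  let v : Fin n → smoothFun E M := fun j ↦ ⟨g.ip V (X' j).1, h (X' j)⟩
  -- Cramer's rule: the adjugate of the Gram matrix of a frame gives a smooth `W` with `V = W / det
  -- G` wherever `det G` is nonzero, in particular near `p`.
  let W : smoothVF E M := ∑ i, (Matrix.vecMul v G.adjugate i) • X' i
  have hGp : G.det.1 p ≠ 0 := by
    intro h0
    have h1 : ((evalAt p).mapMatrix G).det = 0 := by rw [← RingHom.map_det]; exact h0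
    obtain ⟨c, hc0, hc⟩ := Matrix.exists_vecMul_eq_zero_iff.2 h1
    apply hc0
    have h2 : ∑ i, c i • (X' i).1 p = 0 := by
      apply g.eq_zero_of_inner_self (p := p)
      conv_lhs => rw [map_sum]
      refine Finset.sum_eq_zero fun j _ ↦ ?_
      rw [map_smul, ← vecMul_gram, show Matrix.vecMul c _ j = 0 from congrFun hc j, smul_zero]
    have h3 : ∑ i, c i • b i = 0 := by
      rw [← h2]
      exact Finset.sum_congr rfl fun i _ ↦ by rw [← hXp]
    funext i
    exact Fintype.linearIndependent_iff.1 b.linearIndependent c h3 i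
  have hW : ∀ q, G.det.1 q ≠ 0 → V q = (G.det.1 q)⁻¹ • W.1 q := by
    intro q hq
    have : FiniteDimensional ℝ (TangentSpace 𝓘(ℝ, E) q) :=
      inferInstanceAs (FiniteDimensional ℝ E)
    have hdet : ((evalAt q).mapMatrix G).det = G.det.1 q := by rw [← RingHom.map_det]; rfl
    have hli : LinearIndependent ℝ fun i ↦ (X' i).1 q := by
      rw [Fintype.linearIndependent_iff]
      intro c hc i
      have h1 : Matrix.vecMul c ((evalAt q).mapMatrix G) = 0 := by
        funext j
        rw [vecMul_gram g X' q c j, hc, map_zero]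
        rfl
      exact congrFun (Matrix.eq_zero_of_vecMul_eq_zero (by rwa [hdet]) h1) i
    let bq : Module.Basis (Fin n) ℝ (TangentSpace 𝓘(ℝ, E) q) :=
      basisOfLinearIndependentOfCardEqFinrank' _ hli (by simp [n]; rfl)
    obtain ⟨c, hc⟩ : ∃ c : Fin n → ℝ, V q = ∑ i, c i • (X' i).1 q :=
      ⟨bq.repr (V q), by conv_lhs => rw [← bq.sum_repr (V q)]
                         simp [bq]⟩
    have hv : (fun j ↦ (v j).1 q) = Matrix.vecMul c ((evalAt q).mapMatrix G) := by
      funext j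
      rw [vecMul_gram, ← hc]
      rfl
    have h4 : ∀ i, (Matrix.vecMul v G.adjugate i).1 q = G.det.1 q * c i := by
      intro i
      have h5 : (Matrix.vecMul v G.adjugate i).1 q
          = Matrix.vecMul (fun j ↦ (v j).1 q) ((evalAt q).mapMatrix G.adjugate) i :=
        RingHom.map_vecMul (evalAt q) G.adjugate v i
      rw [h5, hv, RingHom.map_adjugate, Matrix.vecMul_vecMul, Matrix.mul_adjugate, hdet]
      simp [Matrix.vecMul_smul]
    have h6 : W.1 q = G.det.1 q • V q := by
      rw [hc, Finset.smul_sum, smoothVF_sum_apply]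
      exact Finset.sum_congr rfl fun i _ ↦ by
        rw [smoothVF_smul_apply, h4, smul_smul]
    rw [h6, inv_smul_smul₀ hq]
  have hinv : ContMDiffAt 𝓘(ℝ, E) 𝓘(ℝ, ℝ) ∞ (fun q ↦ (G.det.1 q)⁻¹) p :=
    ContMDiffAt.inv₀ (G.det.2 p) hGp
  have hs := ContMDiffAt.smul_section hinv (W.2 p)
  refine hs.congr_of_eventuallyEq ?_
  have hcont : ContinuousAt G.det.1 p := (G.det.2 p).continuousAt
  filter_upwards [hcont.eventually_ne hGp] with q hq
  rw [hW q hq]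
  rfl

variable (he : ∃ e : smoothVF E M, g.form e e = 1)

/-- Twice the Koszul expression. -/
def koszulForm (X Y Z : smoothVF E M) : smoothFun E M :=
  vfDeriv g he X (g.form Y Z) + vfDeriv g he Y (g.form X Z) - vfDeriv g he Z (g.form X Y)
    + g.form (lie X Y) Z - g.form (lie X Z) Y - g.form (lie Y Z) X

theorem koszulForm_apply (X Y Z : smoothVF E M) (p : M) :
    (koszulForm g he X Y Z).1 p = 2 * g.koszul X.1 Y.1 Z.1 p := by
  change _ = 2 * (1 / 2 * (dirDeriv X.1 (g.form Y Z).1 p + dirDeriv Y.1 (g.form X Z).1 p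
    - dirDeriv Z.1 (g.form X Y).1 p + (g.form (lie X Y) Z).1 p - (g.form (lie X Z) Y).1 p
    - (g.form (lie Y Z) X).1 p))
  rw [← mul_assoc, mul_one_div_cancel two_ne_zero, one_mul]
  rfl

include he in
theorem nabla_smooth (X Y : smoothVF E M) : IsSmoothVF (g.nabla X.1 Y.1) := by
  apply isSmoothVF_of_inner g
  intro Z
  have h : g.ip (g.nabla X.1 Y.1) Z.1
      = (algebraMap ℝ (smoothFun E M) (1 / 2) * koszulForm g he X Y Z).1 := by
    funext p
    rw [smoothFun_mul_apply, koszulForm_apply]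
    change g.inner p _ _ = (1 / 2) * (2 * _)
    rw [Metric.nabla_spec g X.2 Y.2 Z.2]
    ring
  rw [h]
  exact Subtype.property (p := fun φ ↦ φ ∈ smoothFun E M) _

/-- The Levi-Civita connection on smooth vector fields. -/
def nablaVF (X Y : smoothVF E M) : smoothVF E M := ⟨g.nabla X.1 Y.1, nabla_smooth g he X Y⟩

theorem two_mul_form_nablaVF (X Y Z : smoothVF E M) :
    2 * g.form (nablaVF g he X Y) Z = koszulForm g he X Y Z := by
  ext p
  rw [koszulForm_apply, ← Metric.nabla_spec g X.2 Y.2 Z.2]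
  rfl

theorem ext_form {X Y : smoothVF E M} (h : ∀ Z, 2 * g.form X Z = 2 * g.form Y Z) : X = Y := by
  rw [← sub_eq_zero]
  apply g.form_definite
  apply eq_zero_of_two_mul
  rw [LinearMap.map_sub₂, mul_sub, h, sub_self]

theorem lie_neg_left (X Y : smoothVF E M) : lie (-X) Y = -lie X Y := by
  have h := lie_add_left (-X) X Y
  have h0 := lie_add_left 0 0 Y
  rw [add_zero, left_eq_add] at h0
  rw [neg_add_cancel, h0] at h
  exact eq_neg_of_add_eq_zero_left h.symm

theorem lie_smul_left (X Y : smoothVF E M) (a : smoothFun E M) :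
    lie (a • X) Y = a • lie X Y - vfDeriv g he Y a • X := by
  rw [lie_swap, lie_smul_right g he, lie_swap Y X]
  module

theorem vfDeriv_mul (X : smoothVF E M) (a b : smoothFun E M) :
    vfDeriv g he X (a * b) = a * vfDeriv g he X b + b * vfDeriv g he X a := by
  rw [Derivation.leibniz, smul_eq_mul, smul_eq_mul]

theorem nablaVF_add_left (X X' Y : smoothVF E M) :
    nablaVF g he (X + X') Y = nablaVF g he X Y + nablaVF g he X' Y := by
  apply ext_form g
  intro Z
  simp only [map_add, LinearMap.add_apply, mul_add, two_mul_form_nablaVF, koszulForm,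
    lie_add_left, Derivation.add_apply]
  ring

theorem nablaVF_add_right (X Y Y' : smoothVF E M) :
    nablaVF g he X (Y + Y') = nablaVF g he X Y + nablaVF g he X Y' := by
  apply ext_form g
  intro Z
  simp only [map_add, LinearMap.add_apply, mul_add, two_mul_form_nablaVF, koszulForm,
    lie_add_left, lie_add_right, Derivation.add_apply]
  ring

theorem nablaVF_smul_left (a : smoothFun E M) (X Y : smoothVF E M) :
    nablaVF g he (a • X) Y = a • nablaVF g he X Y := by
  apply ext_form g
  intro Z
  have h := two_mul_form_nablaVF g he X Y Z
  rw [map_smul, LinearMap.smul_apply, smul_eq_mul, two_mul_form_nablaVF, mul_left_comm, h]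
  simp only [koszulForm, map_smul, LinearMap.smul_apply, smul_eq_mul, vfDeriv_mul, map_sub,
    LinearMap.sub_apply, lie_smul_left g he, Derivation.smul_apply]
  rw [g.form_symm X Z]
  ring

theorem nablaVF_smul_right (a : smoothFun E M) (X Y : smoothVF E M) :
    nablaVF g he X (a • Y) = a • nablaVF g he X Y + vfDeriv g he X a • Y := by
  apply ext_form g
  intro Z
  have h := two_mul_form_nablaVF g he X Y Z
  rw [map_add, map_smul, LinearMap.add_apply, LinearMap.smul_apply, smul_eq_mul,
    two_mul_form_nablaVF, mul_add, mul_left_comm, h]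
  simp only [koszulForm, map_smul, map_add, LinearMap.add_apply, LinearMap.smul_apply, smul_eq_mul,
    vfDeriv_mul, map_sub,
    LinearMap.sub_apply, lie_smul_left g he, lie_smul_right g he, Derivation.smul_apply]
  rw [g.form_symm Y X]
  ring

theorem nablaVF_sub_nablaVF (X Y : smoothVF E M) :
    nablaVF g he X Y - nablaVF g he Y X = lie X Y := by
  apply ext_form g
  intro Z
  rw [map_sub, LinearMap.sub_apply, mul_sub, two_mul_form_nablaVF, two_mul_form_nablaVF,
    koszulForm, koszulForm, lie_swap Y X, g.form_symm Y X, map_neg, LinearMap.neg_apply]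
  ring

theorem vfDeriv_form (X Y Z : smoothVF E M) : vfDeriv g he X (g.form Y Z)
    = g.form (nablaVF g he X Y) Z + g.form Y (nablaVF g he X Z) := by
  rw [← sub_eq_zero]
  apply eq_zero_of_two_mul
  rw [g.form_symm Y (nablaVF g he X Z), mul_sub, mul_add, two_mul_form_nablaVF, two_mul_form_nablaVF,
    koszulForm, koszulForm, lie_swap Z Y, g.form_symm Z Y, map_neg, LinearMap.neg_apply,
    g.form_symm X Y, g.form_symm X Z]
  ring

/-- The Levi-Civita connection of a Riemannian manifold which carries a unit vector field. -/
def leviCivita : LeviCivita (smoothFun E M) (smoothVF E M) where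
  g := g.form
  d := vfDeriv g he
  D :=
    { toFun := fun X ↦
        { toFun := nablaVF g he X
          map_zero' := by simpa using nablaVF_smul_right g he 0 X 0
          map_add' := nablaVF_add_right g he X }
      map_add' := fun X X' ↦ AddMonoidHom.ext fun Y ↦ nablaVF_add_left g he X X' Y
      map_smul' := fun a X ↦ AddMonoidHom.ext fun Y ↦ nablaVF_smul_left g he a X Y }
  g_symm := g.form_symm
  g_definite := g.form_definite
  D_smul X a Y := nablaVF_smul_right g he a X Y
  d_g := vfDeriv_form g he
  d_bracket X Y a := by
    change vfDeriv g he (nablaVF g he X Y - nablaVF g he Y X) a = _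
    rw [nablaVF_sub_nablaVF, vfDeriv_lie]
  jacobi X Y Z := by
    have h : ∀ X Y : smoothVF E M, nablaVF g he X Y - nablaVF g he Y X = lie X Y :=
      nablaVF_sub_nablaVF g he
    change nablaVF g he (nablaVF g he X Y - nablaVF g he Y X) Z
      - nablaVF g he Z (nablaVF g he X Y - nablaVF g he Y X)
      + (nablaVF g he (nablaVF g he Y Z - nablaVF g he Z Y) X
      - nablaVF g he X (nablaVF g he Y Z - nablaVF g he Z Y))
      + (nablaVF g he (nablaVF g he Z X - nablaVF g he X Z) Y
      - nablaVF g he Y (nablaVF g he Z X - nablaVF g he X Z)) = 0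
    simp only [h]
    rw [lie_swap (lie Y Z) X, lie_lie X Y Z, lie_swap Z X, lie_swap (-lie X Z) Y,
      lie_swap Y (-lie X Z), lie_swap Y (lie X Z)]
    rw [lie_neg_left]
    abel

theorem leviCivita_curvature (X Y Z : smoothVF E M) :
    ((leviCivita g he).R X Y Z).1 = g.curvature X.1 Y.1 Z.1 := by
  funext p
  have h : (leviCivita g he).R X Y Z = nablaVF g he X (nablaVF g he Y Z)
    - nablaVF g he Y (nablaVF g he X Z)
    - nablaVF g he (nablaVF g he X Y - nablaVF g he Y X) Z := rfl
  rw [h, nablaVF_sub_nablaVF]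
  rfl

end Connection

/-! ### The geometric structure as an instance of the algebraic one. -/

namespace MetricFStructure

variable {n s : ℕ} {E : Type*} [NormedAddCommGroup E] [NormedSpace ℝ E] [FiniteDimensional ℝ E]
  {M : Type*} [TopologicalSpace M] [T2Space M] [ChartedSpace E M] [IsManifold 𝓘(ℝ, E) ∞ M]
  (S : MetricFStructure n s E M)

theorem g_ξ (α : Fin s) (p : M) (v : TangentSpace 𝓘(ℝ, E) p) :
    S.g.inner p (S.ξ α p) v = S.η α p v := by
  have h := S.g_f_f p (S.ξ α p) v
  simp only [S.f_ξ, map_zero, ContinuousLinearMap.zero_apply, S.η_ξ, ite_mul, one_mul, zero_mul,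
    Finset.sum_ite_eq', Finset.mem_univ, if_true] at h
  linarith

theorem g_f_skew (p : M) (v w : TangentSpace 𝓘(ℝ, E) p) :
    S.g.inner p (S.f p v) w = -S.g.inner p v (S.f p w) := by
  have h := S.g_f_f p v (S.f p w)
  have h1 : S.g.inner p (S.f p v) w
      = -S.g.inner p (S.f p v) (S.f p (S.f p w)) := by
    rw [S.f_sq p w, map_add, map_neg, map_sum]
    simp only [map_smul]
    have h2 : ∀ α, S.g.inner p (S.f p v) (S.ξ α p) = 0 := fun α ↦ by
      rw [S.g.symm, S.g_ξ, S.η_f]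
    simp [h2]
  rw [h1, h]
  simp [S.η_f]

theorem fV_smooth (X : smoothVF E M) : IsSmoothVF (S.fV X.1) :=
  ContMDiff.clm_bundle_apply (IB := 𝓘(ℝ, E)) (b := id) (F₁ := E) (F₂ := E)
    (E₁ := (TangentSpace 𝓘(ℝ, E) : M → Type _)) (E₂ := (TangentSpace 𝓘(ℝ, E) : M → Type _))
    S.smooth_f X.2

/-- The `f`-structure as an endomorphism of the module of smooth vector fields. -/
def fEnd : smoothVF E M →ₗ[smoothFun E M] smoothVF E M where
  toFun X := ⟨S.fV X.1, S.fV_smooth X⟩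
  map_add' X Y := by
    ext p
    exact map_add (S.f p) _ _
  map_smul' a X := by
    ext p
    exact map_smul (S.f p) (a.1 p) (X.1 p)

/-- The structure fields as elements of the module of smooth vector fields. -/
def ξField (α : Fin s) : smoothVF E M := ⟨S.ξ α, S.smooth_ξ α⟩

theorem form_ξField (α : Fin s) (X : smoothVF E M) (p : M) :
    (S.g.form (S.ξField α) X).1 p = S.η α p (X.1 p) := S.g_ξ α p _

theorem form_ξField_ξField (α β : Fin s) :
    S.g.form (S.ξField α) (S.ξField β) = if α = β then 1 else 0 := by
  ext p
  rw [form_ξField]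
  change S.η α p (S.ξ β p) = _
  rw [S.η_ξ]
  split_ifs <;> rfl

theorem exists_unit (hs : 0 < s) : ∃ e : smoothVF E M, S.g.form e e = 1 :=
  ⟨S.ξField ⟨0, hs⟩, by rw [form_ξField_ξField, if_pos rfl]⟩

theorem contact_form (hs : 0 < s) (hS : S.IsMetricFContact) (α : Fin s) (X Y : smoothVF E M) :
    vfDeriv S.g (S.exists_unit hs) X (S.g.form (S.ξField α) Y)
      - vfDeriv S.g (S.exists_unit hs) Y (S.g.form (S.ξField α) X)
      - S.g.form (S.ξField α) (lie X Y) = 2 * S.g.form X (S.fEnd Y) := by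
  ext p
  have h := hS α X.1 Y.1 X.2 Y.2 p
  have h1 : ∀ Z : smoothVF E M, (fun q ↦ S.η α q (Z.1 q)) = (S.g.form (S.ξField α) Z).1 :=
    fun Z ↦ funext fun q ↦ (S.form_ξField α Z q).symm
  rw [extD, h1, h1] at h
  have h2 : S.η α p (bracket X.1 Y.1 p) = (S.g.form (S.ξField α) (lie X Y)).1 p :=
    (S.form_ξField α (lie X Y) p).symm
  rw [h2] at h
  change _ = 2 * S.g.ip X.1 (S.fV Y.1) p
  rw [← h]
  change dirDeriv X.1 _ p - dirDeriv Y.1 _ p - _ = _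
  ring

/-- The algebraic data of a metric `f`-contact manifold. -/
def toFContact (hs : 0 < s) (hS : S.IsMetricFContact) :
    FContact (smoothFun E M) (smoothVF E M) (Fin s) where
  toLeviCivita := leviCivita S.g (S.exists_unit hs)
  f := S.fEnd
  ξ := S.ξField
  f_skew X Y := by
    ext p
    exact S.g_f_skew p _ _
  f_sq X := by
    ext p
    rw [smoothVF_add_apply, smoothVF_sum_apply]
    change S.f p (S.f p (X.1 p)) = -X.1 p + ∑ α, (S.g.form (S.ξField α) X).1 p • S.ξ α p
    simp only [form_ξField]
    exact S.f_sq p _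
  f_ξ α := by
    ext p
    exact S.f_ξ α p
  g_ξ_ξ := S.form_ξField_ξField
  contact α X Y := by
    have h := S.contact_form hs hS α X Y
    have e := S.exists_unit hs
    rw [vfDeriv_form, vfDeriv_form, ← nablaVF_sub_nablaVF S.g (S.exists_unit hs) X Y, map_sub] at h
    refine Eq.trans ?_ h
    change S.g.form (nablaVF S.g e X (S.ξField α)) Y - S.g.form (nablaVF S.g e Y (S.ξField α)) X = _
    ring

/-- The link between the operators `h_α` of the statement and the algebra: `h_α = f B_α`, by
`lie_ξ_f`. -/
theorem h_apply (hs : 0 < s) (hS : S.IsMetricFContact) (α : Fin s) (X : smoothVF E M) :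
    S.h α X.1 = (S.fEnd ((S.toFContact hs hS).B α X)).1 := by
  have : Nonempty (Fin s) := ⟨⟨0, hs⟩⟩
  have h := (S.toFContact hs hS).lie_ξ_f α X
  have h1 : ∀ X Y : smoothVF E M, (S.toFContact hs hS).D X Y - (S.toFContact hs hS).D Y X
      = lie X Y := nablaVF_sub_nablaVF S.g (S.exists_unit hs)
  rw [h1, h1] at h
  funext p
  have h2 := congrFun (congrArg Subtype.val h) p
  change (1 / 2 : ℝ) • (bracket (S.ξ α) (S.fV X.1) p - S.f p (bracket (S.ξ α) X.1 p)) = _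
  refine (congrArg ((1 / 2 : ℝ) • ·) h2).trans ?_
  change (1 / 2 : ℝ) • ((S.fEnd ((S.toFContact hs hS).B α X)).1 p
    + (S.fEnd ((S.toFContact hs hS).B α X)).1 p) = _
  module

theorem toFContact_ηbar (hs : 0 < s) (hS : S.IsMetricFContact) (X : smoothVF E M) (p : M) :
    ((S.toFContact hs hS).ηbar X).1 p = S.ηbar X.1 p := by
  rw [FContact.ηbar_eq_sum]
  change (evalAt p) (∑ α, S.g.form (S.ξField α) X) = _
  rw [map_sum]
  exact Finset.sum_congr rfl fun α _ ↦ S.form_ξField α X p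

/-- The algebraic data of a metric `f`-`(κ,μ)` manifold. -/
def toFNullity (hs : 0 < s) {κ μ : ℝ} (hS : S.IsFKappaMu κ μ) :
    FNullity (smoothFun E M) (smoothVF E M) (Fin s) where
  toFContact := S.toFContact hs hS.1
  κ := algebraMap ℝ _ κ
  μ := algebraMap ℝ _ μ
  d_κ X := Derivation.map_algebraMap _ _
  d_μ X := Derivation.map_algebraMap _ _
  nullity α X Y := by
    apply Subtype.ext
    refine (leviCivita_curvature S.g (S.exists_unit hs) X Y (S.ξField α)).trans ?_
    funext p
    refine (hS.2 α X.1 Y.1 X.2 Y.2 p).trans ?_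
    rw [S.h_apply hs hS.1, S.h_apply hs hS.1, ← S.toFContact_ηbar hs hS.1,
      ← S.toFContact_ηbar hs hS.1]
    rfl

theorem h_eq (hs : 0 < s) {κ μ : ℝ} (hS : S.IsFKappaMu κ μ) (α β : Fin s) (X : VField E M)
    (hX : IsSmoothVF X) : S.h α X = S.h β X := by
  have : Nonempty (Fin s) := ⟨⟨0, hs⟩⟩
  rw [S.h_apply hs hS.1 α ⟨X, hX⟩, S.h_apply hs hS.1 β ⟨X, hX⟩]
  have h := (S.toFNullity hs hS).B_eq α β
  exact congrArg (fun T : smoothVF E M →ₗ[smoothFun E M] smoothVF E M ↦ (S.fEnd (T ⟨X, hX⟩)).1) h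

end MetricFStructure

section Values

variable {E : Type*} [NormedAddCommGroup E] [NormedSpace ℝ E]
  {M : Type*} [TopologicalSpace M] [ChartedSpace E M] [IsManifold 𝓘(ℝ, E) ∞ M]

@[simp] theorem smoothFun_sub_apply (φ ψ : smoothFun E M) (p : M) :
    (φ - ψ).1 p = φ.1 p - ψ.1 p := rfl

@[simp] theorem smoothFun_neg_apply (φ : smoothFun E M) (p : M) : (-φ).1 p = -φ.1 p := rfl

@[simp] theorem smoothFun_pow_apply (φ : smoothFun E M) (k : ℕ) (p : M) :
    (φ ^ k).1 p = φ.1 p ^ k := rfl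

@[simp] theorem smoothFun_one_apply (p : M) : (1 : smoothFun E M).1 p = 1 := rfl

@[simp] theorem smoothFun_algebraMap_apply (c : ℝ) (p : M) :
    (algebraMap ℝ (smoothFun E M) c).1 p = c := rfl

end Values

/-! ### Pointwise choices of horizontal fields, and the range of `κ`. -/

namespace MetricFStructure

variable {n s : ℕ} {E : Type*} [NormedAddCommGroup E] [NormedSpace ℝ E] [FiniteDimensional ℝ E]
  {M : Type*} [TopologicalSpace M] [T2Space M] [ChartedSpace E M] [IsManifold 𝓘(ℝ, E) ∞ M]
  (S : MetricFStructure n s E M)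

/-- These are `s + 2` linear conditions on a space of dimension `2n + s`; here `n > 1` enters. -/
theorem exists_horizontal_orthogonal (hn : 1 < n) (hE : Module.finrank ℝ E = 2 * n + s) (p : M)
    (u : TangentSpace 𝓘(ℝ, E) p) : ∃ w : TangentSpace 𝓘(ℝ, E) p, w ≠ 0 ∧ (∀ α, S.η α p w = 0) ∧
      S.g.inner p u w = 0 ∧ S.g.inner p (S.f p u) w = 0 := by
  have : FiniteDimensional ℝ (TangentSpace 𝓘(ℝ, E) p) := inferInstanceAs (FiniteDimensional ℝ E)
  let L : TangentSpace 𝓘(ℝ, E) p →ₗ[ℝ] (Fin s → ℝ) × ℝ × ℝ :=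
    (LinearMap.pi fun α ↦ (S.η α p).toLinearMap).prod
      ((S.g.inner p u).toLinearMap.prod (S.g.inner p (S.f p u)).toLinearMap)
  have hL : ¬ Function.Injective L := by
    intro h
    have h1 := LinearMap.finrank_le_finrank_of_injective h
    have h2 : Module.finrank ℝ (TangentSpace 𝓘(ℝ, E) p) = 2 * n + s := hE
    rw [h2] at h1
    simp at h1
    omega
  rw [← LinearMap.ker_eq_bot, Submodule.eq_bot_iff] at hL
  push Not at hL
  obtain ⟨w, hw, hw0⟩ := hL
  have h1 : L w = 0 := hw
  exact ⟨w, hw0, fun α ↦ congrFun (congrArg Prod.fst h1) α,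
    congrArg (fun x ↦ x.2.1) h1, congrArg (fun x ↦ x.2.2) h1⟩

variable (hs : 0 < s) {κ μ : ℝ} (hS : S.IsFKappaMu κ μ)

theorem mem_hor_iff {X : smoothVF E M} :
    X ∈ (S.toFNullity hs hS).hor ↔ ∀ p α, S.η α p (X.1 p) = 0 := by
  rw [FContact.mem_hor]
  constructor
  · intro h p α
    rw [← S.form_ξField]
    exact congrFun (congrArg Subtype.val (h α)) p
  · intro h α
    ext p
    exact (S.form_ξField α X p).trans (h p α)

theorem exists_mem_hor {p : M} {w : TangentSpace 𝓘(ℝ, E) p} (hw : ∀ α, S.η α p w = 0) :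
    ∃ X ∈ (S.toFNullity hs hS).hor, X.1 p = w := by
  obtain ⟨Z, hZ, hZp⟩ := exists_isSmoothVF w
  let Z' : smoothVF E M := ⟨Z, hZ⟩
  -- `-f²` is the projection onto horizontal fields, so it corrects any smooth extension of `w`
  -- without changing its value at `p`.
  refine ⟨-S.fEnd (S.fEnd Z'), Submodule.neg_mem _ ((S.toFNullity hs hS).f_mem_hor _), ?_⟩
  change -S.f p (S.f p (Z p)) = w
  rw [hZp, S.f_sq]
  simp [hw]

theorem exists_mem_hor_orthogonal (hn : 1 < n) (hE : Module.finrank ℝ E = 2 * n + s)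
    (X : smoothVF E M) (p : M) : ∃ Y ∈ (S.toFNullity hs hS).hor, Y.1 p ≠ 0 ∧
      (S.g.form X Y).1 p = 0 ∧ (S.g.form (S.fEnd X) Y).1 p = 0 := by
  obtain ⟨w, hw0, hw, h1, h2⟩ := S.exists_horizontal_orthogonal hn hE p (X.1 p)
  obtain ⟨Y, hY, hYp⟩ := S.exists_mem_hor hs hS hw
  refine ⟨Y, hY, by rwa [hYp], ?_, ?_⟩
  · rw [Metric.form_apply, hYp]; exact h1
  · rw [Metric.form_apply, hYp]; exact h2

theorem form_self_ne_zero {X : smoothVF E M} {p : M} (h : X.1 p ≠ 0) : (S.g.form X X).1 p ≠ 0 :=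
  (S.g.pos p _ h).ne'

theorem sectional_eq_iff (X : smoothVF E M) {p : M} (h0 : X.1 p ≠ 0)
    (hX : ∀ α, S.η α p (X.1 p) = 0) (c : ℝ) : S.g.sectional X.1 (S.fV X.1) p = c ↔
      (S.g.form ((S.toFNullity hs hS).R X (S.fEnd X) (S.fEnd X)) X).1 p
        = c * (S.g.form X X).1 p ^ 2 := by
  have h1 : S.g.ip (S.fV X.1) (S.fV X.1) p = (S.g.form X X).1 p := by
    refine (S.g_f_f p _ _).trans ?_
    simp [hX]
    rfl
  have h2 : S.g.ip X.1 (S.fV X.1) p = 0 := by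
    have := S.g_f_skew p (X.1 p) (X.1 p)
    rw [S.g.symm] at this
    change S.g.inner p (X.1 p) (S.f p (X.1 p)) = 0
    linarith
  have h3 : S.g.ip (S.g.curvature X.1 (S.fV X.1) (S.fV X.1)) X.1 p
      = (S.g.form ((S.toFNullity hs hS).R X (S.fEnd X) (S.fEnd X)) X).1 p := by
    have := leviCivita_curvature S.g (S.exists_unit hs) X (S.fEnd X) (S.fEnd X)
    rw [Metric.form_apply]
    exact congrArg (fun V ↦ S.g.inner p (V p) (X.1 p)) this.symm
  have h4 : S.g.ip X.1 X.1 p = (S.g.form X X).1 p := rfl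
  rw [Metric.sectional, h1, h2, h3, h4, div_eq_iff]
  · ring_nf
  · have h5 := S.form_self_ne_zero h0
    rw [zero_pow two_ne_zero, sub_zero]
    exact mul_ne_zero h5 h5

-- Near `p` the function is the quotient of `g(R(X, fX)fX, X)` by `g(X, X)²`, for a horizontal field
-- `X` with `X(p) ≠ 0`.
include hs hS in
theorem exists_sectional_smooth (hn : 1 < n) (hE : Module.finrank ℝ E = 2 * n + s)
    (hconst : ∀ p : M, ∃ c : ℝ, S.FSectionalCurvatureEqAt p c) :
    ∃ H : smoothFun E M, ∀ p, S.FSectionalCurvatureEqAt p (H.1 p) := by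
  choose H hH using hconst
  refine ⟨⟨H, fun p ↦ ?_⟩, hH⟩
  obtain ⟨X, hX, hXp, -, -⟩ := S.exists_mem_hor_orthogonal hs hS hn hE 0 p
  let u := S.g.form X X
  let w := S.g.form ((S.toFNullity hs hS).R X (S.fEnd X) (S.fEnd X)) X
  have hu : u.1 p ^ 2 ≠ 0 := pow_ne_zero 2 (S.form_self_ne_zero hXp)
  have hinv : ContMDiffAt 𝓘(ℝ, E) 𝓘(ℝ, ℝ) ∞ (fun q ↦ (u.1 q ^ 2)⁻¹) p :=
    ContMDiffAt.inv₀ ((u ^ 2).2 p) hu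
  have hcont : ContinuousAt (fun q ↦ u.1 q) p := (u.2 p).continuousAt
  refine (ContMDiffAt.mul (w.2 p) hinv).congr_of_eventuallyEq ?_
  filter_upwards [hcont.eventually_ne (S.form_self_ne_zero hXp)] with q hq
  have hq0 : X.1 q ≠ 0 := by
    intro h0
    apply hq
    change S.g.inner q (X.1 q) (X.1 q) = 0
    rw [h0, map_zero]
  have h := (S.sectional_eq_iff hs hS X hq0 ((S.mem_hor_iff hs hS).1 hX q) (H q)).1
    (hH q X.1 X.2 hq0 ((S.mem_hor_iff hs hS).1 hX q))
  change H q = w.1 q * (u.1 q ^ 2)⁻¹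
  rw [← div_eq_mul_inv, eq_div_iff (pow_ne_zero 2 hq)]
  exact h.symm

theorem sectional_form {H : smoothFun E M} (hH : ∀ p, S.FSectionalCurvatureEqAt p (H.1 p))
    {X : smoothVF E M} (hX : X ∈ (S.toFNullity hs hS).hor) :
    S.g.form ((S.toFNullity hs hS).R X (S.fEnd X) (S.fEnd X)) X = H * S.g.form X X ^ 2 := by
  ext p
  by_cases h0 : X.1 p = 0
  · have h1 : ∀ Z : smoothVF E M, (S.g.form Z X).1 p = 0 := fun Z ↦ by
      rw [Metric.form_apply, h0, map_zero]
    rw [smoothFun_mul_apply, smoothFun_pow_apply, h1, h1]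
    ring
  · exact (S.sectional_eq_iff hs hS X h0 ((S.mem_hor_iff hs hS).1 hX p) (H.1 p)).1
      (hH p X.1 X.2 h0 ((S.mem_hor_iff hs hS).1 hX p))

theorem form_b_b [Nonempty (Fin s)] {X : smoothVF E M} (hX : X ∈ (S.toFNullity hs hS).hor) :
    S.g.form ((S.toFNullity hs hS).b X) ((S.toFNullity hs hS).b X)
      = (1 - algebraMap ℝ _ κ) * S.g.form X X := by
  refine ((S.toFNullity hs hS).b_symm X _).trans ?_
  rw [(S.toFNullity hs hS).b_b_hor hX, map_smul]
  rfl

-- The reason is `|bX|² = (1 - κ)|X|²` for a horizontal field that is nonzero at some point.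
include hs hS in
theorem kappa_le_one [Nonempty M] (hn : 1 < n) (hE : Module.finrank ℝ E = 2 * n + s) : κ ≤ 1 := by
  have : Nonempty (Fin s) := ⟨⟨0, hs⟩⟩
  obtain ⟨p⟩ := ‹Nonempty M›
  obtain ⟨X, hX, hXp, -, -⟩ := S.exists_mem_hor_orthogonal hs hS hn hE 0 p
  have h := congrFun (congrArg Subtype.val (S.form_b_b hs hS hX)) p
  rw [smoothFun_mul_apply, smoothFun_sub_apply, smoothFun_one_apply,
    smoothFun_algebraMap_apply] at h
  have h1 : 0 < (S.g.form X X).1 p := S.g.pos p _ hXp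
  have h2 : 0 ≤ (S.g.form ((S.toFNullity hs hS).b X) ((S.toFNullity hs hS).b X)).1 p := by
    by_cases h0 : ((S.toFNullity hs hS).b X).1 p = 0
    · rw [Metric.form_apply, h0, map_zero]
    · exact (S.g.pos p _ h0).le
  rw [h] at h2
  nlinarith

theorem b_eq_zero [Nonempty (Fin s)] (hκ : κ = 1) : (S.toFNullity hs hS).b = 0 := by
  ext1 X
  apply S.g.form_definite
  refine ((S.toFNullity hs hS).b_symm X _).trans ?_
  rw [(S.toFNullity hs hS).b_b]
  have : (S.toFNullity hs hS).κ = 1 := by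
    change algebraMap ℝ (smoothFun E M) κ = 1
    rw [hκ, map_one]
  rw [this, sub_self, zero_smul, map_zero]

theorem regular [Nonempty (Fin s)] (hκ : κ ≤ 1) : (S.toFNullity hs hS).Regular := by
  obtain h | h := hκ.lt_or_eq
  · refine Or.inl ⟨algebraMap ℝ _ (1 - κ)⁻¹, ?_⟩
    change (1 - algebraMap ℝ (smoothFun E M) κ) * _ = 1
    rw [← map_one (algebraMap ℝ (smoothFun E M)), ← map_sub, ← map_mul,
      mul_inv_cancel₀ (by linarith), map_one]
  · exact Or.inr (S.b_eq_zero hs hS h)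

theorem h_eq_b [Nonempty (Fin s)] (α : Fin s) (X : smoothVF E M) :
    S.h α X.1 = (S.fEnd ((S.toFNullity hs hS).b X)).1 := by
  rw [S.h_apply hs hS.1]
  exact congrArg (fun T : smoothVF E M →ₗ[smoothFun E M] smoothVF E M ↦ (S.fEnd (T X)).1)
    ((S.toFNullity hs hS).B_eq_b α)

end MetricFStructure

open Topology in
/-- A function with vanishing derivative on a connected manifold is constant. -/
theorem eq_of_mfderiv_eq_zero {E : Type*} [NormedAddCommGroup E] [NormedSpace ℝ E]
    {M : Type*} [TopologicalSpace M] [ChartedSpace E M] [IsManifold 𝓘(ℝ, E) ∞ M]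
    [PreconnectedSpace M] {φ : M → ℝ} (hφ : MDiff φ)
    (h : ∀ p, mfderiv 𝓘(ℝ, E) 𝓘(ℝ, ℝ) φ p = 0) (p q : M) : φ p = φ q := by
  have : IsManifold 𝓘(ℝ, E) 1 M := IsManifold.of_le (n := ∞) (by simp)
  refine IsLocallyConstant.apply_eq_of_isPreconnected (s := Set.univ) ?_ isPreconnected_univ
    trivial trivial
  rw [IsLocallyConstant.iff_eventually_eq]
  intro p
  let e := chartAt E p
  have hd : ∀ y ∈ e.target, HasMFDerivAt 𝓘(ℝ, E) 𝓘(ℝ, ℝ) (φ ∘ e.symm) y 0 := by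
    intro y hy
    have h1 : HasMFDerivAt 𝓘(ℝ, E) 𝓘(ℝ, ℝ) φ (e.symm y) 0 := by
      rw [← h (e.symm y)]
      exact (hφ _).hasMFDerivAt
    have h2 : MDifferentiableAt 𝓘(ℝ, E) 𝓘(ℝ, E) e.symm y :=
      mdifferentiableAt_atlas_symm (chart_mem_atlas E p) hy
    have h3 := h1.comp y h2.hasMFDerivAt
    rwa [ContinuousLinearMap.zero_comp] at h3
  have hf : ∀ y ∈ e.target, HasFDerivAt (φ ∘ e.symm) (0 : E →L[ℝ] ℝ) y := fun y hy ↦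
    (hasMFDerivAt_iff_hasFDerivAt).1 (hd y hy)
  have ho := e.open_target.isOpen_inter_preimage_of_fderiv_eq_zero (𝕜 := ℝ) (f := φ ∘ e.symm)
    (fun y hy ↦ (hf y hy).differentiableAt.differentiableWithinAt)
    (fun y hy ↦ (hf y hy).fderiv) {φ p}
  have ho' := e.isOpen_inter_preimage ho
  have hp : p ∈ e.source := mem_chart_source E p
  filter_upwards [ho'.mem_nhds ⟨hp, e.map_source hp, by simp [e.left_inv hp]⟩] with q hq
  have := hq.2.2
  simpa [e.left_inv hq.1] using this

/-! ### The curvature formula on the manifold. -/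

namespace MetricFStructure

variable {n s : ℕ} {E : Type*} [NormedAddCommGroup E] [NormedSpace ℝ E] [FiniteDimensional ℝ E]
  {M : Type*} [TopologicalSpace M] [T2Space M] [ChartedSpace E M] [IsManifold 𝓘(ℝ, E) ∞ M]
  (S : MetricFStructure n s E M) (hs : 0 < s) {κ μ : ℝ} (hS : S.IsFKappaMu κ μ)

include hs hS in
theorem curvatureFormula [Nonempty (Fin s)] (hκ : κ ≤ 1) {c : ℝ}
    (hH : ∀ p, S.FSectionalCurvatureEqAt p c) (α : Fin s) : S.CurvatureFormula κ μ c (S.h α) := by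
  intro X Y Z hX hY hZ p
  let N := S.toFNullity hs hS
  let X' : smoothVF E M := ⟨X, hX⟩
  let Y' : smoothVF E M := ⟨Y, hY⟩
  let Z' : smoothVF E M := ⟨Z, hZ⟩
  let H : smoothFun E M := algebraMap ℝ _ c
  have hsec : ∀ X ∈ N.hor, N.g (N.R X (N.f X) (N.f X)) X = H * N.g X X ^ 2 :=
    fun X hX ↦ S.sectional_form hs hS (H := H) hH hX
  have key : ∀ W, 4 * N.g (N.R X' Y' Z') W = N.curvatureForm H X' Y' Z' W :=
    fun W ↦ N.curvature_eq (S.regular hs hS hκ) H hsec X' Y' Z' W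
  have hfb : ∀ V : smoothVF E M, S.fEnd (S.fEnd (N.b V)) = -N.b V := N.f_f_b
  have hh : ∀ V : smoothVF E M, S.h α V.1 = (S.fEnd (N.b V)).1 := S.h_eq_b hs hS α
  have hR : S.g.curvature X Y Z = (N.R X' Y' Z').1 :=
    (leviCivita_curvature S.g (S.exists_unit hs) X' Y' Z').symm
  have hη : ∀ V : smoothVF E M, S.ηbar V.1 p = (N.ηbar V).1 p := fun V ↦
    (S.toFContact_ηbar hs hS.1 V p).symm
  have hinj : ∀ v w : TangentSpace 𝓘(ℝ, E) p,
      (∀ u : smoothVF E M, S.g.inner p v (u.1 p) = S.g.inner p w (u.1 p)) → v = w := by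
    intro v w h
    obtain ⟨U, hU, hUp⟩ := exists_isSmoothVF (v - w)
    have h1 := h ⟨U, hU⟩
    rw [← sub_eq_zero]
    apply S.g.eq_zero_of_inner_self
    have h2 : S.g.inner p v (v - w) = S.g.inner p w (v - w) := by rw [← hUp]; exact h1
    rw [map_sub (S.g.inner p) v w, ContinuousLinearMap.sub_apply, h2, sub_self]
  apply hinj
  intro W
  have k := congrFun (congrArg Subtype.val (key W)) p
  have hξ : S.g.inner p (S.ξbar p) (W.1 p) = (N.ηbar W).1 p := by
    rw [← hη, ξbar, map_sum, ContinuousLinearMap.sum_apply]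
    exact Finset.sum_congr rfl fun α _ ↦ S.g_ξ α p _
  have e1 : S.h α X = (S.fEnd (N.b X')).1 := hh X'
  have e2 : S.h α Y = (S.fEnd (N.b Y')).1 := hh Y'
  have e3 : S.h α Z = (S.fEnd (N.b Z')).1 := hh Z'
  have e6 : S.ηbar X p = (N.ηbar X').1 p := hη X'
  have e7 : S.ηbar Y p = (N.ηbar Y').1 p := hη Y'
  have e8 : S.ηbar Z p = (N.ηbar Z').1 p := hη Z'
  have hf : ∀ V : smoothVF E M, S.fV V.1 = (S.fEnd V).1 := fun _ ↦ rfl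
  have f1 : S.fV X = (S.fEnd X').1 := rfl
  have f2 : S.fV Y = (S.fEnd Y').1 := rfl
  have f3 : S.fV Z = (S.fEnd Z').1 := rfl
  have gipX : ∀ V : smoothVF E M, S.g.ip X V.1 p = (S.g.form X' V).1 p := fun _ ↦ rfl
  have gipY : ∀ V : smoothVF E M, S.g.ip Y V.1 p = (S.g.form Y' V).1 p := fun _ ↦ rfl
  have gipX' : ∀ V : smoothVF E M, S.g.ip V.1 X p = (S.g.form V X').1 p := fun _ ↦ rfl
  have gipZ' : ∀ V : smoothVF E M, S.g.ip V.1 Z p = (S.g.form V Z').1 p := fun _ ↦ rfl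
  have gW : ∀ V : smoothVF E M, S.g.inner p (V.1 p) (W.1 p) = (S.g.form V W).1 p := fun _ ↦ rfl
  simp only [e1, e2, e3, e6, e7, e8, f1, f2, f3, hf, gipX, gipY, gipX', gipZ', hR,
    map_add, map_sub, map_smul, ContinuousLinearMap.add_apply, ContinuousLinearMap.sub_apply,
    ContinuousLinearMap.smul_apply, gW, hξ, smul_eq_mul]
  have hNg : N.g = S.g.form := rfl
  have hNf : N.f = S.fEnd := rfl
  have hNs : N.s.1 p = s := congrArg (Nat.cast : ℕ → ℝ) (Fintype.card_fin s)
  have hNκ : N.κ.1 p = κ := rfl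
  have hNμ : N.μ.1 p = μ := rfl
  have h2 : (2 : smoothFun E M).1 p = 2 := rfl
  have h3 : (3 : smoothFun E M).1 p = 3 := rfl
  have h4 : (4 : smoothFun E M).1 p = 4 := rfl
  have hHc : H.1 p = c := rfl
  simp only [FNullity.curvatureForm, smoothFun_add_apply, smoothFun_sub_apply, smoothFun_mul_apply,
    h2, h3, h4, hNg, hNf, hNs, hNκ, hNμ, hHc] at k
  -- Here `f h = f f b = -b`; such factors occur in pairs, so the signs cancel.
  simp only [hfb, map_neg, LinearMap.neg_apply, smoothFun_neg_apply, neg_mul_neg]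
  exact k

end MetricFStructure

/-! ### Eigenfields of `b`. -/

namespace FNullity

variable {F V ι : Type*} [CommRing F] [Algebra ℝ F] [AddCommGroup V] [Module F V]
    [Fintype ι] [DecidableEq ι] (S : FNullity F V ι) [Nonempty ι]

/-- As `b² = c²` on horizontal fields, `c + b` maps into the `c`-eigenspace. This yields global
eigenfields without diagonalising `b`. -/
theorem b_smul_add {c : F} (hc : c * c = 1 - S.κ) {Z : V} (hZ : Z ∈ S.hor) :
    S.b (c • Z + S.b Z) = c • (c • Z + S.b Z) := by
  rw [map_add, map_smul, S.b_b_hor hZ, smul_add, smul_smul, hc, add_comm]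

/-- `c - b` maps into the `(-c)`-eigenspace, which `f` exchanges with the `c`-eigenspace. -/
theorem b_f_smul_sub {c : F} (hc : c * c = 1 - S.κ) {Z : V} (hZ : Z ∈ S.hor) :
    S.b (S.f (c • Z - S.b Z)) = c • S.f (c • Z - S.b Z) := by
  have h : S.b (c • Z - S.b Z) = -(c • (c • Z - S.b Z)) := by
    rw [map_sub, map_smul, S.b_b_hor hZ, smul_sub, smul_smul, hc]
    abel
  rw [b_f, h, map_neg, neg_neg, map_smul]

theorem b_smul_sub_smul {c : F} {X Y : V} (hX : S.b X = c • X) (hY : S.b Y = c • Y) (a a' : F) :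
    S.b (a • Y - a' • X) = c • (a • Y - a' • X) := by
  rw [map_sub, map_smul, map_smul, hX, hY]
  module

/-- `X` and `f Y` belong to the distinct eigenvalues `c` and `-c` of a symmetric operator. -/
theorem g_f_eq_zero_of_eigen {c c' : F} (hc : c' * c = 1) {X Y : V} (hX : S.b X = c • X)
    (hY : S.b Y = c • Y) : S.g X (S.f Y) = 0 := by
  have h := S.b_symm X (S.f Y)
  rw [b_f, hX, hY, map_smul, map_smul, map_neg, map_smul, LinearMap.smul_apply, smul_eq_mul] at h
  apply eq_zero_of_two_mul
  linear_combination c' * h - 2 * S.g X (S.f Y) * hc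

/-- The part of `Y` orthogonal to `X` and `f X`, up to the factor `g(X, X)`. -/
def orthPart (X Y : V) : V := S.g X X • Y - S.g X Y • X - S.g (S.f X) Y • S.f X

theorem orthPart_mem_hor {X Y : V} (hX : X ∈ S.hor) (hY : Y ∈ S.hor) : S.orthPart X Y ∈ S.hor :=
  sub_mem (sub_mem (S.hor.smul_mem _ hY) (S.hor.smul_mem _ hX))
    (S.hor.smul_mem _ (S.f_mem_hor X))

theorem g_orthPart (X Y : V) : S.g X (S.orthPart X Y) = 0 := by
  simp only [orthPart, map_sub, map_smul, smul_eq_mul, S.g_f_self]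
  ring

theorem g_f_orthPart {X : V} (hX : X ∈ S.hor) (Y : V) : S.g X (S.f (S.orthPart X Y)) = 0 := by
  simp only [orthPart, map_sub, map_smul, smul_eq_mul, S.g_f_self, S.f_f_hor hX, map_neg]
  linear_combination S.g X X * S.f_skew X Y

end FNullity

/-! ### The values of `μ` and `H`, and the constancy of `H`. -/

namespace MetricFStructure

variable {n s : ℕ} {E : Type*} [NormedAddCommGroup E] [NormedSpace ℝ E] [FiniteDimensional ℝ E]
  {M : Type*} [TopologicalSpace M] [T2Space M] [ChartedSpace E M] [IsManifold 𝓘(ℝ, E) ∞ M]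
  (S : MetricFStructure n s E M) (hs : 0 < s) {κ μ : ℝ} (hS : S.IsFKappaMu κ μ)

theorem orthPart_apply [Nonempty (Fin s)] {X Y : smoothVF E M} {p : M}
    (h1 : (S.g.form X Y).1 p = 0) (h2 : (S.g.form (S.fEnd X) Y).1 p = 0) :
    ((S.toFNullity hs hS).orthPart X Y).1 p = (S.g.form X X).1 p • Y.1 p := by
  change (S.g.form X X).1 p • Y.1 p - (S.g.form X Y).1 p • X.1 p
    - (S.g.form (S.fEnd X) Y).1 p • (S.fEnd X).1 p = _
  rw [h1, h2, zero_smul, zero_smul, sub_zero, sub_zero]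

/-- The candidates are `(c + b)Z` and `f (c - b)Z`. Both cannot vanish at `p`, since `(c + b)Z + (c
- b)Z = 2cZ`, and each is orthogonal to `X` at `p` because `X` is an eigenfield. -/
theorem exists_eigen [Nonempty (Fin s)] {c : ℝ} (hc0 : c ≠ 0) (hc : c * c = 1 - κ)
    {X Z : smoothVF E M} (hZ : Z ∈ (S.toFNullity hs hS).hor)
    (hX : (S.toFNullity hs hS).b X = algebraMap ℝ (smoothFun E M) c • X) {p : M}
    (hZp : Z.1 p ≠ 0) (h1 : (S.g.form X Z).1 p = 0) (h2 : (S.g.form (S.fEnd X) Z).1 p = 0) :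
    ∃ Y ∈ (S.toFNullity hs hS).hor,
      (S.toFNullity hs hS).b Y = algebraMap ℝ (smoothFun E M) c • Y ∧
      Y.1 p ≠ 0 ∧ (S.g.form X Y).1 p = 0 := by
  let N := S.toFNullity hs hS
  let C := algebraMap ℝ (smoothFun E M) c
  have hC : C * C = 1 - N.κ := by
    change C * C = 1 - algebraMap ℝ (smoothFun E M) κ
    rw [← map_mul, hc, map_sub, map_one]
  have hXb : ∀ U, S.g.form X (N.b U) = C * S.g.form X U := by
    intro U
    refine (N.b_symm X U).symm.trans ?_
    rw [hX, map_smul]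
    rfl
  have hfX : ∀ U, S.g.form X (S.fEnd U) = -S.g.form (S.fEnd X) U := fun U ↦ by
    rw [← neg_eq_iff_eq_neg]; exact (N.f_skew X U).symm
  have hfXb : ∀ U, S.g.form (S.fEnd X) (N.b U) = -C * S.g.form (S.fEnd X) U := by
    intro U
    refine (N.b_symm (S.fEnd X) U).symm.trans ?_
    have : N.b (S.fEnd X) = -C • S.fEnd X := by
      refine (N.b_f X).trans ?_
      rw [hX, map_smul, neg_smul]
      rfl
    rw [this, map_smul]
    rfl
  by_cases hP : (C • Z + N.b Z).1 p = 0
  · refine ⟨S.fEnd (C • Z - N.b Z), N.f_mem_hor _, N.b_f_smul_sub hC hZ, ?_, ?_⟩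
    · intro hQ
      have h3 : S.f p (S.f p ((C • Z - N.b Z).1 p)) = 0 := by
        rw [show S.f p ((C • Z - N.b Z).1 p) = 0 from hQ, map_zero]
      have h4 : S.fEnd (S.fEnd (C • Z - N.b Z)) = -(C • Z - N.b Z) :=
        N.f_f_hor (sub_mem (N.hor.smul_mem _ hZ) (N.b_mem_hor Z))
      have h5 : (-(C • Z - N.b Z)).1 p = 0 := by rw [← h4]; exact h3
      have h6 : c • Z.1 p + (N.b Z).1 p = 0 := hP
      have h7 : -(c • Z.1 p - (N.b Z).1 p) = 0 := h5
      have h8 : (2 * c) • Z.1 p = 0 := by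
        have : (2 * c) • Z.1 p
          = (c • Z.1 p + (N.b Z).1 p) - -(c • Z.1 p - (N.b Z).1 p) := by module
        rw [this, h6, h7, sub_zero]
      exact (smul_ne_zero (mul_ne_zero two_ne_zero hc0) hZp) h8
    · rw [hfX, map_sub, map_smul, hfXb]
      change -(c * (S.g.form (S.fEnd X) Z).1 p - -c * (S.g.form (S.fEnd X) Z).1 p) = 0
      rw [h2]
      ring
  · refine ⟨C • Z + N.b Z, add_mem (N.hor.smul_mem _ hZ) (N.b_mem_hor Z), N.b_smul_add hC hZ, hP, ?_⟩
    rw [map_add, map_smul, hXb]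
    change c * (S.g.form X Z).1 p + c * (S.g.form X Z).1 p = 0
    rw [h1]
    ring

include hS in
theorem eq_of_kappa_lt_one (hs : 0 < s) (hn : 1 < n) (hE : Module.finrank ℝ E = 2 * n + s)
    (hκ : κ < 1) {H : smoothFun E M} (hH : ∀ p, S.FSectionalCurvatureEqAt p (H.1 p)) (p : M) :
    μ = κ + 1 ∧ H.1 p = -(s : ℝ) * (2 * κ + 1) := by
  have : Nonempty (Fin s) := ⟨⟨0, hs⟩⟩
  let N := S.toFNullity hs hS
  have hreg : N.Regular := S.regular hs hS hκ.le
  have hsec : ∀ X ∈ N.hor, N.g (N.R X (N.f X) (N.f X)) X = H * N.g X X ^ 2 :=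
    fun X hX ↦ S.sectional_form hs hS hH hX
  let c := Real.sqrt (1 - κ)
  have hc0 : c ≠ 0 := (Real.sqrt_pos.2 (by linarith)).ne'
  have hc : c * c = 1 - κ := Real.mul_self_sqrt (by linarith)
  let C := algebraMap ℝ (smoothFun E M) c
  have hC : C * C = 1 - N.κ := by
    change C * C = 1 - algebraMap ℝ (smoothFun E M) κ
    rw [← map_mul, hc, map_sub, map_one]
  have hC1 : algebraMap ℝ (smoothFun E M) c⁻¹ * C = 1 := by
    rw [← map_mul, inv_mul_cancel₀ hc0, map_one]
  obtain ⟨Z, hZ, hZp, hZ1, hZ2⟩ := S.exists_mem_hor_orthogonal hs hS hn hE 0 p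
  -- The zero field counts as an eigenfield, so the first choice carries no orthogonality condition.
  obtain ⟨X, hX, hbX, hXp, -⟩ := S.exists_eigen hs hS hc0 hc (X := 0) hZ
    ((LinearMap.map_zero _).trans (smul_zero _).symm) hZp hZ1 (by
    rw [LinearMap.map_zero]; exact hZ1)
  obtain ⟨Z', hZ', hZp', h1, h2⟩ := S.exists_mem_hor_orthogonal hs hS hn hE X p
  obtain ⟨Y, hY, hbY, hYp, hXY⟩ := S.exists_eigen hs hS hc0 hc hZ' hbX hZp' h1 h2
  -- `Y` is orthogonal to `X` only at `p`. A Gram–Schmidt step without division makes the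
  -- orthogonality global and multiplies the value at `p` by `g(X, X)`.
  let Y' := S.g.form X X • Y - S.g.form X Y • X
  have hY' : Y' ∈ N.hor := sub_mem (N.hor.smul_mem _ hY) (N.hor.smul_mem _ hX)
  have hbY' : N.b Y' = C • Y' := N.b_smul_sub_smul hbX hbY _ _
  have hXY' : N.g X Y' = 0 := by
    change S.g.form X Y' = 0
    rw [map_sub, map_smul, map_smul, smul_eq_mul, smul_eq_mul]
    ring
  have hYp' : Y'.1 p ≠ 0 := by
    change (S.g.form X X).1 p • Y.1 p - (S.g.form X Y).1 p • X.1 p ≠ 0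
    rw [hXY, zero_smul, sub_zero]
    exact smul_ne_zero (S.form_self_ne_zero hXp) hYp
  have e1 := congrFun (congrArg Subtype.val
    (N.sectional_of_eigen hreg hC hX hbX (hsec X hX))) p
  have e2 := congrFun (congrArg Subtype.val (N.sectional_of_eigen_orthogonal hreg hC hX hY' hbX
    hbY' hXY' (N.g_f_eq_zero_of_eigen hC1 hbX hbY') hsec)) p
  have hNs : N.s.1 p = s := congrArg (Nat.cast : ℕ → ℝ) (Fintype.card_fin s)
  have e1' : c * (H.1 p + N.s.1 p * (κ + μ)) * (S.g.form X X).1 p ^ 2 = 0 := e1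
  have e2' : c * (H.1 p - N.s.1 p + 2 * N.s.1 p * μ)
    * ((S.g.form X X).1 p * (S.g.form Y' Y').1 p) = 0 := e2
  have hXX := S.form_self_ne_zero hXp
  have hYY := S.form_self_ne_zero hYp'
  rw [hNs] at e1' e2'
  simp only [mul_eq_zero, hc0, hXX, hYY, false_or, or_false, pow_eq_zero_iff, ne_eq,
    OfNat.ofNat_ne_zero, not_false_eq_true] at e1' e2'
  have hs' : (s : ℝ) ≠ 0 := Nat.cast_ne_zero.2 hs.ne'
  have h3 : (s : ℝ) * (μ - (κ + 1)) = 0 := by linear_combination e2' - e1'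
  have h4 : μ = κ + 1 := by
    rcases mul_eq_zero.1 h3 with h | h
    · exact absurd h hs'
    · linarith
  refine ⟨h4, ?_⟩
  rw [h4] at e1'
  linear_combination e1'

theorem vfDeriv_eq_zero_of_kappa_eq_one [Nonempty (Fin s)] (hn : 1 < n)
    (hE : Module.finrank ℝ E = 2 * n + s) (hκ : κ = 1) {H : smoothFun E M}
    (hH : ∀ p, S.FSectionalCurvatureEqAt p (H.1 p)) (X : smoothVF E M) :
    (S.toFNullity hs hS).d X H = 0 := by
  let N := S.toFNullity hs hS
  have hb : N.b = 0 := S.b_eq_zero hs hS hκ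
  have hκ' : N.κ = 1 := by
    change algebraMap ℝ (smoothFun E M) κ = 1
    rw [hκ, map_one]
  have hsec : ∀ X ∈ N.hor, N.g (N.R X (N.f X) (N.f X)) X = H * N.g X X ^ 2 :=
    fun X hX ↦ S.sectional_form hs hS hH hX
  have hval : ∀ {p : M} {Y : smoothVF E M} {a : smoothFun E M}, Y.1 p ≠ 0 →
      a * S.g.form Y Y ^ 2 = 0 → a.1 p = 0 := by
    intro p Y a hY h
    have h1 : a.1 p * (S.g.form Y Y).1 p ^ 2 = 0 := congrFun (congrArg Subtype.val h) p
    exact (mul_eq_zero.1 h1).resolve_right (pow_ne_zero 2 (S.form_self_ne_zero hY))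
  induction X using N.hor_induction with
  | h X hX =>
    ext p
    by_cases hXp : X.1 p = 0
    · change mvfderiv 𝓘(ℝ, E) H.1 p (X.1 p) = 0
      rw [hXp, map_zero]
    · obtain ⟨Y, hY, hYp, h1, h2⟩ := S.exists_mem_hor_orthogonal hs hS hn hE X p
      -- `orthPart` is orthogonal to `X` and `f X` everywhere, and at `p` it is a nonzero multiple
      -- of `Y`.
      refine hval (Y := N.orthPart X Y) ?_ (N.d_hor_eq_zero hb hsec hX (N.orthPart_mem_hor hX hY)
        (N.g_orthPart X Y) (N.g_f_orthPart hX Y))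
      rw [S.orthPart_apply hs hS h1 h2]
      exact smul_ne_zero (S.form_self_ne_zero hXp) hYp
  | hξ α =>
    ext p
    obtain ⟨Y, hY, hYp, -, -⟩ := S.exists_mem_hor_orthogonal hs hS hn hE 0 p
    exact hval hYp (N.d_ξ_eq_zero hb hκ' hsec hY α)
  | hadd X Y hX hY => rw [map_add, Derivation.add_apply, hX, hY, add_zero]
  | hsmul a X hX => rw [map_smul, Derivation.smul_apply, hX, smul_zero]

include hs hS in
theorem eq_of_kappa_eq_one [PreconnectedSpace M] (hn : 1 < n)
    (hE : Module.finrank ℝ E = 2 * n + s) (hκ : κ = 1) {H : smoothFun E M}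
    (hH : ∀ p, S.FSectionalCurvatureEqAt p (H.1 p)) (p q : M) : H.1 p = H.1 q := by
  have : Nonempty (Fin s) := ⟨⟨0, hs⟩⟩
  refine eq_of_mfderiv_eq_zero (smoothFun_mdiffAt H) (fun p ↦ ?_) p q
  ext v
  obtain ⟨X, hX, hXp⟩ := exists_isSmoothVF v
  have h := congrFun (congrArg Subtype.val
    (S.vfDeriv_eq_zero_of_kappa_eq_one hs hS hn hE hκ hH ⟨X, hX⟩)) p
  rw [← hXp]
  exact h

end MetricFStructure
end FKappaMu

end

/-! ### Assembly of the theorem. -/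

theorem theorem3p1 (n s : ℕ) (hn : 1 < n) (hs : 0 < s)
    (M : Type*) [TopologicalSpace M] [T2Space M] [ConnectedSpace M]
    [ChartedSpace (EuclideanSpace ℝ (Fin (2 * n + s))) M]
    [IsManifold 𝓘(ℝ, EuclideanSpace ℝ (Fin (2 * n + s))) ∞ M]
    (S : FKappaMu.MetricFStructure n s (EuclideanSpace ℝ (Fin (2 * n + s))) M)
    (κ μ : ℝ) (hS : S.IsFKappaMu κ μ)
    (hconst : ∀ p : M, ∃ c : ℝ, S.FSectionalCurvatureEqAt p c) :
    (∀ α β, ∀ X, FKappaMu.IsSmoothVF X → S.h α X = S.h β X) ∧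
    ∃ H : ℝ, (∀ p : M, S.FSectionalCurvatureEqAt p H) ∧
      (∀ α, S.CurvatureFormula κ μ H (S.h α)) ∧
      (κ < 1 → μ = κ + 1 ∧ H = -(s : ℝ) * (2 * κ + 1)) := by
  have hE : Module.finrank ℝ (EuclideanSpace ℝ (Fin (2 * n + s))) = 2 * n + s := by simp
  have : Nonempty (Fin s) := ⟨⟨0, hs⟩⟩
  refine ⟨fun α β X hX ↦ S.h_eq hs hS α β X hX, ?_⟩
  obtain ⟨H, hH⟩ := S.exists_sectional_smooth hs hS hn hE hconst
  have hκ : κ ≤ 1 := S.kappa_le_one hs hS hn hE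
  obtain ⟨p₀⟩ : Nonempty M := inferInstance
  -- For `κ < 1` the value at each point is forced by `κ` and `s`; connectedness is needed only for
  -- `κ = 1`.
  have hconst' : ∀ p, H.1 p = H.1 p₀ := by
    intro p
    obtain h | h := hκ.lt_or_eq
    · rw [(S.eq_of_kappa_lt_one hS hs hn hE h hH p).2,
        (S.eq_of_kappa_lt_one hS hs hn hE h hH p₀).2]
    · exact S.eq_of_kappa_eq_one hs hS hn hE h hH p p₀
  have hH' : ∀ p, S.FSectionalCurvatureEqAt p (H.1 p₀) := fun p ↦ hconst' p ▸ hH p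
  exact ⟨H.1 p₀, hH', fun α ↦ S.curvatureFormula hs hS hκ hH' α,
    fun h ↦ S.eq_of_kappa_lt_one hS hs hn hE h hH p₀⟩
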